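/- **Proposition (complexity of the parametric-LCP algorithm).** Let $1\le k\le n$, $r\in\mathbb R$ and let $x^0\in\mathbb R^n$ be sorted, $x^0_1\ge\dots\ge x^0_n$. The *sorted projection problem* is $$\min_{x\in\mathbb R^n}\ \tfrac12\|x-x^0\|_2^2\quad\text{s.t.}\quad \sum_{i=1}^k x_i\le r,\qquad x_i\ge x_{i+1}\ (1\le i\le n-1).$$ Let $D\in\mathbb R^{(n-1)\times n}$, $(Dx)_i=x_i-x_{i+1}$, let $\mathbb 1_k\in\mathbb R^n$ be the indicator vector of the first $k$ coordinates, and put $M=DD^\top$, $q=Dx^0\ge0$, $d=-D\mathbb 1_k$. For an index set (basis) $\xi\subseteq\{1,\dots,n-1\}$ and $\lambda\in\mathbb R$ let $z^\xi(\lambda)$ be the vector with $z^\xi_\xi(\lambda)=-M_{\xi\xi}^{-1}(q_\xi+\lambda d_\xi)$ and zero entries off $\xi$; $\mathrm{LCP}(q',M)$ asks for $z$ with $0\le Mz+q'\perp z\ge0$. Put $q_0=q_n=+\infty$. *Algorithm.* Let $s=\sum_{i\le k}x^0_i$. (i) If $s\le r$, return $x^0$. (ii) Otherwise, if $k=1$,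 return $(\min\{x^0_i,r\})_i$. (iii) Otherwise, if $k=n$, return $x^0-\frac{s-r}{n}\mathbb 1_n$. (iv) Otherwise, let $\lambda=q_k$; if $s-k\lambda\le r$, return $x^0-\frac{s-r}{k}\mathbb 1_k$. (v) Otherwise start with $\xi=\{a,\dots,b\}=\{k\}$, $z_a=z_k=z_b=-q_k/2$, $\sigma=3/2$ and repeat the following pass. With $m=|\xi|$ and with $p_c$ the position of $c$ in $\xi$, let $m^{-1}(c,c')=\frac{(m+1-\max\{p_c,p_{c'}\})\min\{p_c,p_{c'}\}}{m+1}$. Compute $\lambda^a=\frac{q_{a-1}-z_a}{m^{-1}(k,a)}$, $\lambda^b=\frac{q_{b+1}-z_b}{m^{-1}(k,b)}$ and the next breakpoint $\lambda=\min\{\lambda^a,\lambda^b\}$. If $\lambda=+\infty$ or $s-k\lambda+z_k+m^{-1}(k,k)\lambda\le r$, set $\bar\lambda=\frac{s-r+z_k}{k-m^{-1}(k,k)}$ and stop. Otherwise, if $\lambda=\lambda^a$, set $z_{a-1}=(z_a-q_{a-1})/\sigma$, add $z_{a-1}m^{-1}(k,a)$ to $z_k$ and $z_{a-1}m^{-1}(b,a)$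 to $z_b$, and replace $a$ by $a-1$ (and the maintained $z_a$ by $z_{a-1}$); if $\lambda\ne\lambda^a$, set $z_{b+1}=(z_b-q_{b+1})/\sigma$, add $z_{b+1}m^{-1}(a,b)$ to $z_a$ and $z_{b+1}m^{-1}(k,b)$ to $z_k$, and replace $b$ by $b+1$ (and the maintained $z_b$ by $z_{b+1}$); then set $\sigma=\frac{m'+2}{m'+1}$ with $m'=m+1$ the new size. After stopping, return $\bar x=x^0-\bar\lambda\mathbb 1_k+D^\top z^{\bar\xi}(\bar\lambda)$ for the last basis $\bar\xi=\{a,\dots,b\}$, where $D^\top z^{\bar\xi}(\bar\lambda)$ is added by two cumulative sums of $v=-(q+\bar\lambda d)_{\bar\xi}$: with $m=|\bar\xi|$, $c_1=\frac1{m+1}\sum_{j=1}^m(m+1-j)v_j$ and $c_{i}=c_{i-1}-v_{i-1}$ for $2\le i\le m+1$, the number $c_i$ is added to coordinate $a+i-1$. Cost is counted on a real RAM: constants, register and array accesses, arithmetic operations and comparisons on reals and on integers, and executed assignments and tests cost one unit each. Then: 1. For every $n$, $M$ is a tridiagonal positive definite $Z$-matrix, with $2$ on the diagonal and $-1$ next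 to it. For every contiguous $\xi=\{a,\dots,b\}\subseteq\{1,\dots,n-1\}$ with $m=|\xi|\ge1$, $M_{\xi\xi}$ is invertible and $(M_{\xi\xi}^{-1})_{ij}=\frac{(m+1-\max\{i,j\})\min\{i,j\}}{m+1}$ for positions $1\le i,j\le m$. 2. There is an absolute constant $C$ (independent of $n,k,r,x^0$) such that, for all data as above, the algorithm halts after at most $Cn$ units of time and returns the unique solution of the sorted projection problem. Moreover: * the initialization costs at most $Cn$, there are $N\le n-1$ passes of the main loop, and each pass costs at most $C$; * let $N>0$. The bases $\xi^0,\dots,\xi^{N-1}$ at the start of the passes are contiguous, contain $k$, and satisfy $\xi^0=\{k\}$ and $|\xi^t|=t+1$; $\xi^{t+1}\supsetneq\xi^t$ arises by adding the left or the right neighbour of $\xi^t$; the last pass leaves the basis unchanged, so that $\bar\xi=\xi^{N-1}$; * at the start of pass $t$ the maintained numbers $z_a,z_k,z_b$ are the components $a,k,b$ of $z^{\xi^t}(0)$, and $\sigma$ is the Schur complement $2-(M_{\xi^t\xi^t}^{-1})_{aa}=2-(M_{\xi^t\xi^t}^{-1})_{bb}$; * with $\lambda^0=q_k$, $\lambda^1,\dots,\lambda^{N-1}$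 the breakpoints of the pivots and $\lambda^N:=\bar\lambda$, one has $0\le\lambda^0\le\dots\le\lambda^N$, the zero vector (basis $\emptyset$) solves $\mathrm{LCP}(q+\lambda d,M)$ for $0\le\lambda\le\lambda^0$, and $z^{\xi^t}(\lambda)$ solves it for $\lambda^t\le\lambda\le\lambda^{t+1}$; * writing $x^0-\bar\lambda\mathbb 1_k$ costs at most $Cn$, adding $D^\top z^{\bar\xi}(\bar\lambda)$ to it costs at most $C|\bar\xi|$, and the result is the unique solution of the sorted projection problem. -/

import Mathlib

open Matrix

/-! ### The sorted projection problem -/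

/-- `x` is feasible for the sorted problem: `x 1 + ... + x k ≤ r` and `x` is nonincreasing. -/
def SortedFeasible {n : ℕ} (k : ℕ) (r : ℝ) (x : Fin n → ℝ) : Prop :=
  ∑ i with i.val < k, x i ≤ r ∧ ∀ i j : Fin n, i.val + 1 = j.val → x j ≤ x i

/-- The objective, half the squared Euclidean distance to `x0`. -/
noncomputable def projObjective {n : ℕ} (x0 x : Fin n → ℝ) : ℝ :=
  1 / 2 * ∑ i, (x i - x0 i) ^ 2

/-- `y` is the unique optimal solution of the sorted projection problem. -/
def IsSortedProjection {n : ℕ} (k : ℕ) (r : ℝ) (x0 y : Fin n → ℝ) : Prop :=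
  SortedFeasible k r y ∧
    ∀ x : Fin n → ℝ, SortedFeasible k r x → x ≠ y → projObjective x0 y < projObjective x0 x

/-! ### The parametric linear complementarity problem

Row `i : Fin (n - 1)` carries the index `i + 1` of the one-based numbering `1, ..., n - 1`. -/

/-- The consecutive difference operator, `(D x) i = x i - x (i + 1)`. -/
def isoD (n : ℕ) : Matrix (Fin (n - 1)) (Fin n) ℝ := fun i j =>
  if j.val = i.val then 1 else if j.val = i.val + 1 then -1 else 0

/-- `M = D Dᵀ`. -/
def isoM (n : ℕ) : Matrix (Fin (n - 1)) (Fin (n - 1)) ℝ := isoD n * (isoD n)ᵀ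

/-- The indicator vector of the first `k` coordinates. -/
def onesVec (n k : ℕ) : Fin n → ℝ := fun i => if i.val < k then 1 else 0

/-- `q = D x0`. -/
def plcpQ {n : ℕ} (x0 : Fin n → ℝ) : Fin (n - 1) → ℝ := isoD n *ᵥ x0

/-- The direction `d = - D 1_k`. -/
def plcpD (n k : ℕ) : Fin (n - 1) → ℝ := -(isoD n *ᵥ onesVec n k)

def IsZMatrix {ι : Type*} (A : Matrix ι ι ℝ) : Prop := ∀ i j, i ≠ j → A i j ≤ 0

def IsTridiagonal {m : ℕ} (A : Matrix (Fin m) (Fin m) ℝ) : Prop :=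
  ∀ i j : Fin m, (i.val + 1 < j.val ∨ j.val + 1 < i.val) → A i j = 0

/-- `z` solves the linear complementarity problem `0 ≤ A z + q ⟂ z ≥ 0`. -/
def IsLCPSolution {ι : Type*} [Fintype ι] (A : Matrix ι ι ℝ) (q z : ι → ℝ) : Prop :=
  (∀ i, 0 ≤ z i) ∧ (∀ i, 0 ≤ (A *ᵥ z + q) i) ∧ (A *ᵥ z + q) ⬝ᵥ z = 0

/-- The principal submatrix of `M` on the basis `ξ`. -/
def basisM {n : ℕ} (ξ : Finset (Fin (n - 1))) : Matrix ξ ξ ℝ :=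
  (isoM n).submatrix (fun i => i.1) (fun i => i.1)

/-- The basic solution at the parameter `lam`: it is `- M_ξξ⁻¹ (q + lam d)_ξ` on `ξ` and zero
off `ξ`. -/
noncomputable def basicSolution {n : ℕ} (k : ℕ) (x0 : Fin n → ℝ) (ξ : Finset (Fin (n - 1)))
    (lam : ℝ) : Fin (n - 1) → ℝ := fun i =>
  if h : i ∈ ξ then
    ((basisM ξ)⁻¹ *ᵥ fun j : ξ => -(plcpQ x0 j.1 + lam * plcpD n k j.1)) ⟨i, h⟩
  else 0

/-- The contiguous basis `{a, ..., b}` in the one-based numbering. -/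
def interval (n : ℕ) (a b : ℤ) : Finset (Fin (n - 1)) :=
  Finset.univ.filter fun i => a ≤ (i.val : ℤ) + 1 ∧ (i.val : ℤ) + 1 ≤ b

/-! ### A real RAM with step counting

A small imperative language with integer registers, real registers and real arrays. The cost of an
expression is its number of nodes, so every constant, register access, array access, arithmetic
operation and comparison costs one unit, and every executed assignment and test costs one more. -/

/-- Integer registers: `n` and `k` are inputs, the basis is `{a, ..., b}`, the positions of `k` and
`b` in it are `pk` and `pb` (the position of `a` is always `1`). -/
inductive IVar
  | n | k | a | b | pk | pb | t | i | j | m | left | inf | done | ret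
  deriving DecidableEq

/-- Real registers: `r` is an input, `lam` holds the current breakpoint, `lbar` the final
parameter. -/
inductive RVar
  | r | s | lam | lamA | lamB | lbar | T | za | zk | zb | sig | c
  deriving DecidableEq

/-- Arrays: `x` is the input, `y` the output. -/
inductive Arr
  | x | y
  deriving DecidableEq

structure State where
  int : IVar → ℤ
  real : RVar → ℝ
  arr : Arr → ℤ → ℝ

inductive IExpr
  | lit (z : ℤ)
  | var (v : IVar)
  | add (e f : IExpr)
  | sub (e f : IExpr)
  | min (e f : IExpr)
  | max (e f : IExpr)

inductive RExpr
  | lit (z : ℤ)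
  | var (v : RVar)
  | ofInt (e : IExpr)
  | get (A : Arr) (e : IExpr)
  | neg (e : RExpr)
  | add (e f : RExpr)
  | sub (e f : RExpr)
  | mul (e f : RExpr)
  | div (e f : RExpr)
  | min (e f : RExpr)

inductive Test
  | ile (e f : IExpr)
  | ieq (e f : IExpr)
  | rle (e f : RExpr)
  | req (e f : RExpr)

inductive Stmt
  | skip
  | setI (v : IVar) (e : IExpr)
  | setR (v : RVar) (e : RExpr)
  | put (A : Arr) (e : IExpr) (f : RExpr)
  | seq (p p' : Stmt)
  | ite (b : Test) (p p' : Stmt)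
  | while (b : Test) (p : Stmt)

instance : Add IExpr := ⟨IExpr.add⟩
instance : Sub IExpr := ⟨IExpr.sub⟩
instance (m : ℕ) : OfNat IExpr m := ⟨IExpr.lit m⟩
instance : Coe IVar IExpr := ⟨IExpr.var⟩
instance : Neg RExpr := ⟨RExpr.neg⟩
instance : Add RExpr := ⟨RExpr.add⟩
instance : Sub RExpr := ⟨RExpr.sub⟩
instance : Mul RExpr := ⟨RExpr.mul⟩
instance : Div RExpr := ⟨RExpr.div⟩
instance (m : ℕ) : OfNat RExpr m := ⟨RExpr.lit m⟩
instance : Coe RVar RExpr := ⟨RExpr.var⟩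

def IExpr.eval (σ : State) : IExpr → ℤ
  | .lit z => z
  | .var v => σ.int v
  | .add e f => e.eval σ + f.eval σ
  | .sub e f => e.eval σ - f.eval σ
  | .min e f => Min.min (e.eval σ) (f.eval σ)
  | .max e f => Max.max (e.eval σ) (f.eval σ)

def IExpr.cost : IExpr → ℕ
  | .lit _ => 1
  | .var _ => 1
  | .add e f => e.cost + f.cost + 1
  | .sub e f => e.cost + f.cost + 1
  | .min e f => e.cost + f.cost + 1
  | .max e f => e.cost + f.cost + 1

noncomputable def RExpr.eval (σ : State) : RExpr → ℝ
  | .lit z => z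
  | .var v => σ.real v
  | .ofInt e => ((e.eval σ : ℤ) : ℝ)
  | .get A e => σ.arr A (e.eval σ)
  | .neg e => -e.eval σ
  | .add e f => e.eval σ + f.eval σ
  | .sub e f => e.eval σ - f.eval σ
  | .mul e f => e.eval σ * f.eval σ
  | .div e f => e.eval σ / f.eval σ
  | .min e f => Min.min (e.eval σ) (f.eval σ)

def RExpr.cost : RExpr → ℕ
  | .lit _ => 1
  | .var _ => 1
  | .ofInt e => e.cost + 1
  | .get _ e => e.cost + 1
  | .neg e => e.cost + 1
  | .add e f => e.cost + f.cost + 1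
  | .sub e f => e.cost + f.cost + 1
  | .mul e f => e.cost + f.cost + 1
  | .div e f => e.cost + f.cost + 1
  | .min e f => e.cost + f.cost + 1

def Test.holds (σ : State) : Test → Prop
  | .ile e f => e.eval σ ≤ f.eval σ
  | .ieq e f => e.eval σ = f.eval σ
  | .rle e f => e.eval σ ≤ f.eval σ
  | .req e f => e.eval σ = f.eval σ

def Test.cost : Test → ℕ
  | .ile e f => e.cost + f.cost + 1
  | .ieq e f => e.cost + f.cost + 1
  | .rle e f => e.cost + f.cost + 1
  | .req e f => e.cost + f.cost + 1

def State.setI (σ : State) (v : IVar) (z : ℤ) : State :=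
  { σ with int := Function.update σ.int v z }

def State.setR (σ : State) (v : RVar) (z : ℝ) : State :=
  { σ with real := Function.update σ.real v z }

def State.put (σ : State) (A : Arr) (i : ℤ) (z : ℝ) : State :=
  { σ with arr := Function.update σ.arr A (Function.update (σ.arr A) i z) }

/-- `Exec p σ c σ'`: started in `σ`, the program `p` halts in `σ'` after `c` units of time. -/
inductive Exec : Stmt → State → ℕ → State → Prop
  | skip (σ : State) : Exec .skip σ 0 σ
  | setI (σ : State) (v : IVar) (e : IExpr) :
      Exec (.setI v e) σ (e.cost + 1) (σ.setI v (e.eval σ))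
  | setR (σ : State) (v : RVar) (e : RExpr) :
      Exec (.setR v e) σ (e.cost + 1) (σ.setR v (e.eval σ))
  | put (σ : State) (A : Arr) (e : IExpr) (f : RExpr) :
      Exec (.put A e f) σ (e.cost + f.cost + 1) (σ.put A (e.eval σ) (f.eval σ))
  | seq {p p' : Stmt} {σ σ' σ'' : State} {c c' : ℕ} :
      Exec p σ c σ' → Exec p' σ' c' σ'' → Exec (.seq p p') σ (c + c') σ''
  | iteTrue {b : Test} {p p' : Stmt} {σ σ' : State} {c : ℕ} :
      b.holds σ → Exec p σ c σ' → Exec (.ite b p p') σ (b.cost + 1 + c) σ'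
  | iteFalse {b : Test} {p p' : Stmt} {σ σ' : State} {c : ℕ} :
      ¬ b.holds σ → Exec p' σ c σ' → Exec (.ite b p p') σ (b.cost + 1 + c) σ'
  | whileDone {b : Test} {p : Stmt} {σ : State} :
      ¬ b.holds σ → Exec (.while b p) σ (b.cost + 1) σ
  | whileStep {b : Test} {p : Stmt} {σ σ' σ'' : State} {c c' : ℕ} :
      b.holds σ → Exec p σ c σ' → Exec (.while b p) σ' c' σ'' →
        Exec (.while b p) σ (b.cost + 1 + c + c') σ''

/-- Programs are deterministic. -/
theorem Exec.unique {p : Stmt} {σ σ₁ σ₂ : State} {c₁ c₂ : ℕ}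
    (h₁ : Exec p σ c₁ σ₁) (h₂ : Exec p σ c₂ σ₂) : c₁ = c₂ ∧ σ₁ = σ₂ := by
  induction h₁ generalizing c₂ σ₂ with
  | skip | setI | setR | put => cases h₂; exact ⟨rfl, rfl⟩
  | seq _ _ ih ih' =>
    cases h₂ with
    | seq g g' =>
      obtain ⟨rfl, rfl⟩ := ih g
      obtain ⟨rfl, rfl⟩ := ih' g'
      exact ⟨rfl, rfl⟩
  | iteTrue hb _ ih =>
    cases h₂ with
    | iteTrue _ g => obtain ⟨rfl, rfl⟩ := ih g; exact ⟨rfl, rfl⟩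
    | iteFalse hb' _ => exact absurd hb hb'
  | iteFalse hb _ ih =>
    cases h₂ with
    | iteTrue hb' _ => exact absurd hb' hb
    | iteFalse _ g => obtain ⟨rfl, rfl⟩ := ih g; exact ⟨rfl, rfl⟩
  | whileDone hb =>
    cases h₂ with
    | whileDone _ => exact ⟨rfl, rfl⟩
    | whileStep hb' _ _ => exact absurd hb' hb
  | whileStep hb _ _ ih ih' =>
    cases h₂ with
    | whileDone hb' => exact absurd hb hb'
    | whileStep _ g g' =>
      obtain ⟨rfl, rfl⟩ := ih g
      obtain ⟨rfl, rfl⟩ := ih' g'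
      exact ⟨rfl, rfl⟩

infixr:40 " ;; " => Stmt.seq

/-! ### The pivoting algorithm -/

/-- `q_e = x_e - x_(e+1)`. -/
def qAt (e : IExpr) : RExpr := .get .x e - .get .x (e + 1)

/-- The size `b - a + 1` of the basis. -/
def basisSize : IExpr := IVar.b - IVar.a + (1 : IExpr)

/-- The entry of `M_ξξ⁻¹` at the positions `c` and `d`, computed by the explicit formula
`(|ξ| + 1 - max c d) * min c d / (|ξ| + 1)`. -/
def mInv (c d : IExpr) : RExpr :=
  .ofInt (basisSize + 1 - .max c d) * .ofInt (.min c d) / .ofInt (basisSize + 1)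

/-- `for v = lo, ..., hi do p`. -/
def forLoop (v : IVar) (lo hi : IExpr) (p : Stmt) : Stmt :=
  .setI v lo ;; .while (.ile v hi) (p ;; .setI v (v + (1 : IExpr)))

/-- Return from the initialization: the output is already written. -/
def returnNow : Stmt := .setI .ret 1 ;; .setI .done 1

/-- Write `x - lbar 1_k` to `y`. -/
def writeShifted : Stmt :=
  forLoop .i 1 IVar.k (.put .y IVar.i (.get .x IVar.i - RVar.lbar)) ;;
  forLoop .i (IVar.k + (1 : IExpr)) IVar.n (.put .y IVar.i (.get .x IVar.i))

/-- Initialization: the immediate cases, the empty basis, and the basis `{k}`. -/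
def setup : Stmt :=
  .setR .s 0 ;;
  forLoop .i 1 IVar.k (.setR .s (RVar.s + RExpr.get .x IVar.i)) ;;
  .ite (.rle RVar.s RVar.r)
    (forLoop .i 1 IVar.n (.put .y IVar.i (.get .x IVar.i)) ;; returnNow)
  (.ite (.ieq IVar.k 1)
    (forLoop .i 1 IVar.n (.put .y IVar.i (.min (.get .x IVar.i) RVar.r)) ;; returnNow)
  (.ite (.ieq IVar.k IVar.n)
    (.setR .lbar ((RVar.s - RVar.r) / .ofInt IVar.n) ;; writeShifted ;; returnNow)
  (.setR .lam (qAt IVar.k) ;;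
   .setR .T (RVar.s - .ofInt IVar.k * RVar.lam) ;;
   .ite (.rle RVar.T RVar.r)
    (.setR .lbar ((RVar.s - RVar.r) / .ofInt IVar.k) ;; writeShifted ;; returnNow)
    (.setI .t 1 ;; .setI .a IVar.k ;; .setI .b IVar.k ;; .setI .pk 1 ;; .setI .pb 1 ;;
     .setR .zk (-(qAt IVar.k * mInv IVar.pk IVar.pk)) ;; .setR .za RVar.zk ;; .setR .zb RVar.zk ;;
     .setR .sig (2 - mInv IVar.pk IVar.pk)))))

/-- Compute the next breakpoint `lam = min (lamA, lamB)`. With the convention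
`x_0 = + ∞`, `x_(n+1) = - ∞`, `lamA` is infinite if `a = 1` and `lamB` is infinite if `b = n - 1`;
the register `inf` records `lam = + ∞`, and `left` records `lam = lamA`. -/
def nextBreakpoint : Stmt :=
  .setI .inf 0 ;;
  .setI .left 0 ;;
  .ite (.ile 2 IVar.a)
    (.setR .lamA ((qAt (IVar.a - (1 : IExpr)) - RVar.za) / mInv IVar.pk 1) ;;
     .ite (.ile (IVar.b + (2 : IExpr)) IVar.n)
      (.setR .lamB ((qAt (IVar.b + (1 : IExpr)) - RVar.zb) / mInv IVar.pk IVar.pb) ;;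
       .setR .lam (.min RVar.lamA RVar.lamB) ;;
       .ite (.req RVar.lam RVar.lamA) (.setI .left 1) .skip)
      (.setR .lam RVar.lamA ;; .setI .left 1))
    (.ite (.ile (IVar.b + (2 : IExpr)) IVar.n)
      (.setR .lamB ((qAt (IVar.b + (1 : IExpr)) - RVar.zb) / mInv IVar.pk IVar.pb) ;;
       .setR .lam RVar.lamB)
      (.setI .inf 1))

/-- Stop with the current basis: solve the budget equation for the parameter. -/
def stopPivoting : Stmt :=
  .setR .lbar ((RVar.s - RVar.r + RVar.zk) / (.ofInt IVar.k - mInv IVar.pk IVar.pk)) ;;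
  .setI .done 1

/-- Update the maintained components of `z(0)` and the basis by the Schur complement rule. -/
def updateBasis : Stmt :=
  .ite (.ieq IVar.left 1)
    (.setR .za ((RVar.za - qAt (IVar.a - (1 : IExpr))) / RVar.sig) ;;
     .setR .zk (RVar.zk + RVar.za * mInv IVar.pk 1) ;;
     .setR .zb (RVar.zb + RVar.za * mInv IVar.pb 1) ;;
     .setI .a (IVar.a - (1 : IExpr)) ;;
     .setI .pk (IVar.pk + (1 : IExpr)) ;;
     .setI .pb (IVar.pb + (1 : IExpr)))
    (.setR .zb ((RVar.zb - qAt (IVar.b + (1 : IExpr))) / RVar.sig) ;;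
     .setR .za (RVar.za + RVar.zb * mInv 1 IVar.pb) ;;
     .setR .zk (RVar.zk + RVar.zb * mInv IVar.pk IVar.pb) ;;
     .setI .b (IVar.b + (1 : IExpr)) ;;
     .setI .pb (IVar.pb + (1 : IExpr))) ;;
  .setI .t (IVar.t + (1 : IExpr)) ;;
  .setR .sig (.ofInt (IVar.t + (2 : IExpr)) / .ofInt (IVar.t + (1 : IExpr)))

/-- One pass of the main loop. -/
def pivot : Stmt :=
  nextBreakpoint ;;
  .ite (.ieq IVar.inf 1) stopPivoting
    (.setR .T (RVar.s - .ofInt IVar.k * RVar.lam + RVar.zk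
        + mInv IVar.pk IVar.pk * RVar.lam) ;;
     .ite (.rle RVar.T RVar.r) stopPivoting updateBasis)

/-- The test of the main loop. -/
def running : Test := .ieq IVar.done 0

/-- Add `Dᵀ z` to `y`, where `z` is the basic solution for `{a, ..., b}` at the parameter `lbar`, by
two cumulative sums of the vector `- (q + lbar d)` on the basis. -/
def addDTz : Stmt :=
  .setI .m basisSize ;;
  .setR .c 0 ;;
  forLoop .i 1 IVar.m
    (.setI .j (IVar.b - IVar.i + (1 : IExpr)) ;;
     .setR .c (RVar.c + .ofInt IVar.i * -qAt IVar.j) ;;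
     .ite (.ieq (IVar.m - IVar.i + (1 : IExpr)) IVar.pk)
       (.setR .c (RVar.c + .ofInt IVar.i * RVar.lbar)) .skip) ;;
  .setR .c (RVar.c / .ofInt (IVar.m + (1 : IExpr))) ;;
  .put .y IVar.a (.get .y IVar.a + RVar.c) ;;
  forLoop .i 2 (IVar.m + (1 : IExpr))
    (.setI .j (IVar.a + IVar.i - (2 : IExpr)) ;;
     .setR .c (RVar.c - -qAt IVar.j) ;;
     .ite (.ieq (IVar.i - (1 : IExpr)) IVar.pk) (.setR .c (RVar.c - RVar.lbar)) .skip ;;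
     .put .y (IVar.j + (1 : IExpr)) (.get .y (IVar.j + (1 : IExpr)) + RVar.c))

/-- The complete algorithm. -/
def plcpAlgorithm : Stmt :=
  setup ;;
  .while running pivot ;;
  .ite (.ieq IVar.ret 1) .skip (writeShifted ;; addDTz)

/-- The start state: the inputs are in place and every other cell is zero. -/
noncomputable def startState {n : ℕ} (k : ℕ) (r : ℝ) (x0 : Fin n → ℝ) : State where
  int := fun v => match v with
    | .n => n
    | .k => k
    | _ => 0
  real := fun v => match v with
    | .r => r
    | _ => 0
  arr := fun A j => match A with
    | .x => if h : 1 ≤ j ∧ j ≤ n then x0 ⟨(j - 1).toNat, by omega⟩ else 0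
    | .y => 0

/-- The content of the output array, `y 1, ..., y n`. -/
def State.output (σ : State) (n : ℕ) : Fin n → ℝ := fun i => σ.arr .y ((i.val : ℤ) + 1)

/-- The basis `{a, ..., b}` held by a state (empty in a run that ends during initialization). -/
def State.basis (σ : State) (n : ℕ) : Finset (Fin (n - 1)) := interval n (σ.int .a) (σ.int .b)

/-! By duality the problem becomes a one-parameter family: `x0 - lam 1_k + Dᵀ z` is optimal as soon
as `lam ≥ 0`, `z` solves the LCP with data `q + lam d`, and the budget holds with equality
(`isSortedProjection_of_isLCPSolution`). It remains to follow `z` as `lam` grows until the budget `s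
- k lam + z_k(lam)` has fallen to `r`.

`M` is the negated second difference with zero boundary values. After extension by zero to all of
`ℤ`, a basic solution on `{a, ..., b}` is the solution of a discrete Dirichlet problem
(`SolvesPoisson`), and the inverse matrix is an explicit kernel, piecewise linear and positive on
the interval (`green`). The parameter enters only as a source at `k`, so the basic solution is `z(0)
+ lam * green a b k` (`solutionPath`). Three facts follow. Components never decrease in `lam`, so no
index ever leaves the basis. The only LCP conditions that can break are the rows `q_(a-1) - z_a` and
`q_(b+1) - z_b` of the two neighbours, since the other rows off the basis are entries of `q ≥ 0`.
Finally `green a b k k < k` (`green_self_lt`), so the budget is strictly decreasing in `lam` for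
each fixed basis.

At a breakpoint the row of the entering neighbour vanishes. The old solution, with zero in the new
place, therefore already solves the enlarged system, and by uniqueness (`SolvesPoisson.unique`) the
old and the new path agree there. This carries nonnegativity and the violated budget to the new
basis, while the registers follow by the Schur complement rule (`wp_updateBasis_left`,
`wp_updateBasis_right`). Every pass but the last adds one of the `n - 1` indices, hence at most `n -
1` passes of constant cost. The vector `Dᵀ z` is recovered from the difference equation by two
summations (`addDTz_spec`). Result and cost of the program are derived together in the
total-correctness calculus `WP`. -/

/-! ### Sequences indexed by the integers -/

/-- The entries of `x0`, one-based, extended by zero to all integers. -/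
noncomputable def zeroExt {n : ℕ} (x0 : Fin n → ℝ) : ℤ → ℝ := fun j =>
  if h : 1 ≤ j ∧ j ≤ n then x0 ⟨(j - 1).toNat, by omega⟩ else 0

/-- The consecutive differences of `zeroExt x0`. -/
noncomputable def extDiff {n : ℕ} (x0 : Fin n → ℝ) (j : ℤ) : ℝ := zeroExt x0 j - zeroExt x0 (j + 1)

theorem zeroExt_val_add_one {n : ℕ} (x0 : Fin n → ℝ) (i : Fin n) :
    zeroExt x0 ((i.val : ℤ) + 1) = x0 i := by
  have hi := i.isLt
  rw [zeroExt, dif_pos (by omega)]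
  congr 1
  ext
  simp

theorem extDiff_nonneg {n : ℕ} {x0 : Fin n → ℝ} (hx : Antitone x0) {j : ℤ} (h1 : 1 ≤ j)
    (h2 : j + 1 ≤ n) : 0 ≤ extDiff x0 j := by
  rw [extDiff, zeroExt, zeroExt, dif_pos (by omega), dif_pos (by omega), sub_nonneg]
  apply hx
  rw [Fin.le_def]
  simp only
  omega

/-- `f` vanishes off `{a, ..., b}` and its negated second difference is `u` there. -/
def SolvesPoisson (a b : ℤ) (u f : ℤ → ℝ) : Prop :=
  (∀ i, ¬ (a ≤ i ∧ i ≤ b) → f i = 0) ∧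
    ∀ i, a ≤ i → i ≤ b → 2 * f i - f (i - 1) - f (i + 1) = u i

/-! ### The discrete Dirichlet problem: superposition, uniqueness, enlarging the interval. -/

namespace SolvesPoisson

variable {a b : ℤ} {u v f g : ℤ → ℝ}

theorem add_smul (hf : SolvesPoisson a b u f) (c : ℝ) (hg : SolvesPoisson a b v g) :
    SolvesPoisson a b (fun i => u i + c * v i) (fun i => f i + c * g i) := by
  refine ⟨fun i hi => by simp [hf.1 i hi, hg.1 i hi], fun i h1 h2 => ?_⟩
  have e1 := hf.2 i h1 h2
  have e2 := hg.2 i h1 h2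
  simp only [← e1, ← e2]
  ring

theorem congr_right (hf : SolvesPoisson a b u f) (h : ∀ i, a ≤ i → i ≤ b → u i = v i) :
    SolvesPoisson a b v f :=
  ⟨hf.1, fun i h1 h2 => by rw [hf.2 i h1 h2, h i h1 h2]⟩

/-- The difference of two solutions has zero second difference and vanishes at `a - 1`, so it is
linear: its value at `a - 1 + m` is `m` times its value at `a`. Since it also vanishes at `b + 1`,
the slope is zero. -/
theorem unique (hab : a ≤ b) (hf : SolvesPoisson a b u f) (hg : SolvesPoisson a b u g) :
    f = g := by
  have key : ∀ m : ℕ, (m : ℤ) ≤ b - a + 1 →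
      f (a - 1 + m) - g (a - 1 + m) = m * (f a - g a) ∧
      f (a + m) - g (a + m) = (m + 1) * (f a - g a) := by
    intro m
    induction m with
    | zero =>
      intro _
      simp [hf.1 (a - 1) (by omega), hg.1 (a - 1) (by omega)]
    | succ m ih =>
      intro hm
      push_cast at hm ⊢
      obtain ⟨h1, h2⟩ := ih (by omega)
      have e1 := hf.2 (a + m) (by omega) (by omega)
      have e2 := hg.2 (a + m) (by omega) (by omega)
      rw [show a + (m : ℤ) - 1 = a - 1 + m by ring] at e1 e2
      rw [show a - 1 + ((m : ℤ) + 1) = a + m by ring,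
        show a + ((m : ℤ) + 1) = a + m + 1 by ring]
      exact ⟨h2, by linarith⟩
  have ha : f a - g a = 0 := by
    have e := (key (b - a + 1).toNat (by omega)).2
    rw [hf.1 _ (by omega), hg.1 _ (by omega), sub_self] at e
    exact (mul_eq_zero.mp e.symm).resolve_left (by positivity)
  funext i
  by_cases hi : a ≤ i ∧ i ≤ b
  · have := (key (i - (a - 1)).toNat (by omega)).1
    rw [ha, mul_zero, show a - 1 + (((i - (a - 1)).toNat : ℕ) : ℤ) = i by omega] at this
    linarith
  · rw [hf.1 i hi, hg.1 i hi]

/-- Extension of the interval to the left, where the new equation already holds. -/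
theorem extend_left (hf : SolvesPoisson a b u f) (h : f a = -u (a - 1)) :
    SolvesPoisson (a - 1) b u f := by
  refine ⟨fun i hi => hf.1 i (by omega), fun i h1 h2 => ?_⟩
  rcases eq_or_lt_of_le h1 with rfl | h1
  · rw [hf.1 (a - 1) (by omega), hf.1 (a - 1 - 1) (by omega), sub_add_cancel, h]
    ring
  · exact hf.2 i (by omega) h2

/-- Extension of the interval to the right, where the new equation already holds. -/
theorem extend_right (hf : SolvesPoisson a b u f) (h : f b = -u (b + 1)) :
    SolvesPoisson a (b + 1) u f := by
  refine ⟨fun i hi => hf.1 i (by omega), fun i h1 h2 => ?_⟩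
  rcases eq_or_lt_of_le h2 with rfl | h2
  · rw [hf.1 (b + 1) (by omega), hf.1 (b + 1 + 1) (by omega), add_sub_cancel_right, h]
    ring
  · exact hf.2 i h1 (by omega)

end SolvesPoisson

/-- The entries of the inverse of the principal submatrix of `M` on `{a, ..., b}`. -/
noncomputable def green (a b j i : ℤ) : ℝ :=
  if a ≤ i ∧ i ≤ b then
    (((b - a + 1) + 1 - max (i + 1 - a) (j + 1 - a) : ℤ) : ℝ)
      * ((min (i + 1 - a) (j + 1 - a) : ℤ) : ℝ) / (((b - a + 1) + 1 : ℤ) : ℝ)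
  else 0

/-- The linear formula stays valid one step outside the interval, because its factor vanishes at `a
- 1`. Second differences at the ends thus need no separate case. -/
theorem green_of_le {a b i j : ℤ} (h1 : a - 1 ≤ i) (hij : i ≤ j) (hj : j ≤ b) :
    green a b j i = ((b : ℝ) + 1 - j) * (i + 1 - a) / (b - a + 2) := by
  rw [green]
  split_ifs with h
  · rw [max_eq_right (by omega), min_eq_left (by omega)]
    push_cast
    ring
  · have : (i : ℝ) = a - 1 := by
      have : i = a - 1 := by omega
      rw [this]; push_cast; ring
    rw [this]
    ring

theorem green_of_ge {a b i j : ℤ} (h1 : i ≤ b + 1) (hij : j ≤ i) (hj : a ≤ j) :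
    green a b j i = ((b : ℝ) + 1 - i) * (j + 1 - a) / (b - a + 2) := by
  rw [green]
  split_ifs with h
  · rw [max_eq_left (by omega), min_eq_right (by omega)]
    push_cast
    ring
  · have : (i : ℝ) = b + 1 := by
      have : i = b + 1 := by omega
      rw [this]; push_cast; ring
    rw [this]
    ring

theorem green_pos {a b i j : ℤ} (h1 : a ≤ i) (h2 : i ≤ b) (h3 : a ≤ j) (h4 : j ≤ b) :
    0 < green a b j i := by
  have e1 : (a : ℝ) ≤ i := by exact_mod_cast h1
  have e2 : (i : ℝ) ≤ b := by exact_mod_cast h2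
  have e3 : (a : ℝ) ≤ j := by exact_mod_cast h3
  have e4 : (j : ℝ) ≤ b := by exact_mod_cast h4
  rcases le_total i j with h | h
  · rw [green_of_le (by omega) h h4]
    exact div_pos (mul_pos (by linarith) (by linarith)) (by linarith)
  · rw [green_of_ge (by omega) h h3]
    exact div_pos (mul_pos (by linarith) (by linarith)) (by linarith)

theorem green_nonneg {a b j : ℤ} (h3 : a ≤ j) (h4 : j ≤ b) (i : ℤ) : 0 ≤ green a b j i := by
  by_cases h : a ≤ i ∧ i ≤ b
  · exact (green_pos h.1 h.2 h3 h4).le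
  · rw [green, if_neg h]

/-- The kernel is linear on either side of `j`, and its slope drops by exactly one at `j`. -/
theorem solvesPoisson_green {a b j : ℤ} (h3 : a ≤ j) (h4 : j ≤ b) :
    SolvesPoisson a b (fun i => if i = j then 1 else 0) (green a b j) := by
  have e3 : (a : ℝ) ≤ j := by exact_mod_cast h3
  have e4 : (j : ℝ) ≤ b := by exact_mod_cast h4
  have e5 : (b : ℝ) - a + 2 ≠ 0 := by linarith
  refine ⟨fun i hi => by rw [green, if_neg hi], fun i h1 h2 => ?_⟩
  simp only
  rcases lt_trichotomy i j with h | h | h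
  · rw [green_of_le (by omega) h.le h4, green_of_le (by omega) (by omega) h4,
      green_of_le (by omega) (by omega) h4, if_neg (by omega)]
    push_cast
    field_simp
    ring
  · subst h
    rw [green_of_le (by omega) le_rfl h4, green_of_le (by omega) (by omega) h4,
      green_of_ge (by omega) (by omega) h3, if_pos rfl]
    push_cast
    field_simp
    ring
  · rw [green_of_ge (by omega) h.le h3, green_of_ge (by omega) (by omega) h3,
      green_of_ge (by omega) (by omega) h3, if_neg (by omega)]
    push_cast
    field_simp
    ring

theorem green_left {a b : ℤ} (h : a ≤ b) : green a b a a = ((b : ℝ) - a + 1) / (b - a + 2) := by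
  rw [green_of_le (by omega) le_rfl h]
  ring

theorem green_right {a b : ℤ} (h : a ≤ b) : green a b b b = ((b : ℝ) - a + 1) / (b - a + 2) := by
  rw [green_of_le (by omega) le_rfl le_rfl]
  ring

/-- The value is `j + 1 - a ≤ j` times a fraction below one. With `j = k` this makes the budget
strictly decreasing and the denominator of the final parameter positive. -/
theorem green_self_lt {a b j : ℤ} (h1 : 1 ≤ a) (h3 : a ≤ j) (h4 : j ≤ b) :
    green a b j j < j := by
  have e1 : (1 : ℝ) ≤ a := by exact_mod_cast h1
  have e3 : (a : ℝ) ≤ j := by exact_mod_cast h3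
  have e4 : (j : ℝ) ≤ b := by exact_mod_cast h4
  rw [green_of_le (by omega) le_rfl h4, div_lt_iff₀ (by linarith)]
  nlinarith

/-- The Schur complement rule when the left neighbour enters the basis. -/
theorem SolvesPoisson.schur_left {a b : ℤ} {u f : ℤ → ℝ} (hab : a ≤ b)
    (hf : SolvesPoisson a b u f) {z : ℝ} (hz : z * (2 - green a b a a) = f a + u (a - 1)) :
    SolvesPoisson (a - 1) b u
      (fun i => f i + z * (green a b a i + if i = a - 1 then 1 else 0)) := by
  have hg := solvesPoisson_green le_rfl hab
  refine ⟨fun i hi => ?_, fun i h1 h2 => ?_⟩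
  · simp only
    rw [hf.1 i (by omega), hg.1 i (by omega), if_neg (by omega)]
    ring
  · simp only
    rcases eq_or_lt_of_le h1 with rfl | h1
    · rw [hf.1 (a - 1) (by omega), hf.1 (a - 1 - 1) (by omega), hg.1 (a - 1) (by omega),
        hg.1 (a - 1 - 1) (by omega), sub_add_cancel, if_pos rfl, if_neg (by omega),
        if_neg (by omega)]
      linarith
    · have e1 := hf.2 i (by omega) h2
      have e2 := hg.2 i (by omega) h2
      simp only at e2
      rw [← e1, if_neg (by omega : ¬ i = a - 1), if_neg (by omega : ¬ i + 1 = a - 1)]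
      -- At `a` the unit source of the kernel cancels the contribution of the new value at `a - 1`;
      -- elsewhere both are zero.
      by_cases h : i = a
      · rw [if_pos h] at e2
        rw [if_pos (by omega)]
        linear_combination z * e2
      · rw [if_neg h] at e2
        rw [if_neg (by omega)]
        linear_combination z * e2

/-- The Schur complement rule when the right neighbour enters the basis. -/
theorem SolvesPoisson.schur_right {a b : ℤ} {u f : ℤ → ℝ} (hab : a ≤ b)
    (hf : SolvesPoisson a b u f) {z : ℝ} (hz : z * (2 - green a b b b) = f b + u (b + 1)) :
    SolvesPoisson a (b + 1) u
      (fun i => f i + z * (green a b b i + if i = b + 1 then 1 else 0)) := by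
  have hg := solvesPoisson_green hab le_rfl
  refine ⟨fun i hi => ?_, fun i h1 h2 => ?_⟩
  · simp only
    rw [hf.1 i (by omega), hg.1 i (by omega), if_neg (by omega)]
    ring
  · simp only
    rcases eq_or_lt_of_le h2 with rfl | h2
    · rw [hf.1 (b + 1) (by omega), hf.1 (b + 1 + 1) (by omega), hg.1 (b + 1) (by omega),
        hg.1 (b + 1 + 1) (by omega), add_sub_cancel_right, if_pos rfl, if_neg (by omega),
        if_neg (by omega)]
      linarith
    · have e1 := hf.2 i h1 (by omega)
      have e2 := hg.2 i h1 (by omega)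
      simp only at e2
      rw [← e1, if_neg (by omega : ¬ i = b + 1), if_neg (by omega : ¬ i - 1 = b + 1)]
      by_cases h : i = b
      · rw [if_pos h] at e2
        rw [if_pos (by omega)]
        linear_combination z * e2
      · rw [if_neg h] at e2
        rw [if_neg (by omega)]
        linear_combination z * e2

/-! ### The matrices `D` and `M` acting on restricted sequences -/

/-- The index `l` may lie outside the range of summation, which absorbs the boundary rows of `Dᵀ`.
-/
theorem sum_ite_val_eq {m : ℕ} {f : ℤ → ℝ} {l : ℤ} (h : ¬ (1 ≤ l ∧ l ≤ m) → f l = 0) :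
    ∑ i : Fin m, (if (i.val : ℤ) + 1 = l then f ((i.val : ℤ) + 1) else 0) = f l := by
  by_cases hl : 1 ≤ l ∧ l ≤ m
  · rw [Finset.sum_eq_single (⟨(l - 1).toNat, by omega⟩ : Fin m)]
    · have : (((l - 1).toNat : ℕ) : ℤ) + 1 = l := by omega
      simp only [this, if_true]
    · intro i _ hi
      rw [if_neg]
      intro h'
      apply hi
      ext
      simp only
      omega
    · simp
  · rw [h hl]
    apply Finset.sum_eq_zero
    intro i _
    have := i.isLt
    rw [if_neg (by omega)]

theorem isoD_mulVec {n : ℕ} (x : Fin n → ℝ) (i : Fin (n - 1)) :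
    (isoD n *ᵥ x) i = x ⟨i.val, by omega⟩ - x ⟨i.val + 1, by omega⟩ := by
  have : isoD n i = Pi.single (⟨i.val, by omega⟩ : Fin n) 1
      - Pi.single (⟨i.val + 1, by omega⟩ : Fin n) (1 : ℝ) := by
    ext j
    simp only [isoD, Pi.sub_apply, Pi.single_apply, Fin.ext_iff]
    split_ifs <;> first | omega | norm_num
  simp only [mulVec, this, sub_dotProduct, single_dotProduct, one_mul]

theorem isoD_mulVec_zeroExt {n : ℕ} (x : Fin n → ℝ) (i : Fin (n - 1)) :
    (isoD n *ᵥ x) i = extDiff x ((i.val : ℤ) + 1) := by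
  rw [isoD_mulVec, extDiff]
  have h := i.isLt
  have e1 := zeroExt_val_add_one x ⟨i.val, by omega⟩
  have e2 := zeroExt_val_add_one x ⟨i.val + 1, by omega⟩
  push_cast at e1 e2
  rw [← e1, ← e2]

theorem plcpD_apply (n k : ℕ) (i : Fin (n - 1)) :
    plcpD n k i = if (i.val : ℤ) + 1 = k then -1 else 0 := by
  rw [plcpD, Pi.neg_apply, isoD_mulVec]
  simp only [onesVec]
  split_ifs <;> first | omega | norm_num

theorem plcpQ_add_smul_apply {n : ℕ} (k : ℕ) (x0 : Fin n → ℝ) (lam : ℝ) (i : Fin (n - 1)) :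
    (plcpQ x0 + lam • plcpD n k) i =
      extDiff x0 ((i.val : ℤ) + 1) - lam * if (i.val : ℤ) + 1 = k then 1 else 0 := by
  rw [Pi.add_apply, Pi.smul_apply, plcpD_apply, plcpQ, isoD_mulVec_zeroExt, smul_eq_mul]
  split_ifs <;> ring

/-- The restriction of a sequence to `1, ..., m`. -/
def restrictFin (m : ℕ) (f : ℤ → ℝ) : Fin m → ℝ := fun i => f ((i.val : ℤ) + 1)

/-- The zero values at `0` and `n` stand for the missing terms in the first and the last coordinate,
so all coordinates share one formula. -/
theorem isoD_transpose_mulVec {n : ℕ} {f : ℤ → ℝ}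
    (hf : ∀ i, ¬ (1 ≤ i ∧ i ≤ (n : ℤ) - 1) → f i = 0) (j : Fin n) :
    ((isoD n)ᵀ *ᵥ restrictFin (n - 1) f) j = f ((j.val : ℤ) + 1) - f j.val := by
  have hj := j.isLt
  simp only [mulVec, dotProduct, transpose_apply, restrictFin]
  rw [← sum_ite_val_eq (m := n - 1) (l := (j.val : ℤ) + 1) (f := f) (fun h => hf _ (by omega)),
    ← sum_ite_val_eq (m := n - 1) (l := (j.val : ℤ)) (f := f) (fun h => hf _ (by omega)),
    ← Finset.sum_sub_distrib]
  apply Finset.sum_congr rfl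
  intro i _
  simp only [isoD]
  split_ifs <;> first | omega | simp

theorem isoM_mulVec {n : ℕ} {f : ℤ → ℝ}
    (hf : ∀ i, ¬ (1 ≤ i ∧ i ≤ (n : ℤ) - 1) → f i = 0) (i : Fin (n - 1)) :
    (isoM n *ᵥ restrictFin (n - 1) f) i
      = 2 * f ((i.val : ℤ) + 1) - f i.val - f ((i.val : ℤ) + 2) := by
  rw [isoM, ← mulVec_mulVec, isoD_mulVec, isoD_transpose_mulVec hf, isoD_transpose_mulVec hf]
  push_cast
  rw [show (i.val : ℤ) + 1 + 1 = i.val + 2 by ring]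
  ring

theorem isoM_apply (n : ℕ) (i j : Fin (n - 1)) :
    isoM n i j = if i = j then 2 else if i.val + 1 = j.val ∨ j.val + 1 = i.val then -1 else 0 := by
  -- Column `j` of `Dᵀ` is row `j` of `D`, so an entry of `M` is one difference of that row.
  have : isoM n i j = (isoD n *ᵥ (isoD n j)) i := rfl
  rw [this, isoD_mulVec]
  simp only [isoD, Fin.ext_iff]
  split_ifs <;> first | omega | norm_num

theorem isTridiagonal_isoM (n : ℕ) : IsTridiagonal (isoM n) := by
  intro i j h
  rw [isoM_apply, if_neg (by rw [Fin.ext_iff]; omega), if_neg (by omega)]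

theorem isZMatrix_isoM (n : ℕ) : IsZMatrix (isoM n) := by
  intro i j h
  rw [isoM_apply, if_neg h]
  split_ifs <;> norm_num

/-- If `Dᵀ z = 0`, the zero extension of `z` has no increments on `0, ..., n` and starts at zero.
Injectivity of `Dᵀ` is what makes `D Dᵀ` positive definite. -/
theorem isoD_transpose_mulVec_injective (n : ℕ) : Function.Injective (isoD n)ᵀ.mulVec := by
  change Function.Injective (Matrix.mulVecLin (isoD n)ᵀ)
  rw [injective_iff_map_eq_zero (Matrix.mulVecLin (isoD n)ᵀ)]
  intro z hz
  have hr : z = restrictFin (n - 1) (zeroExt z) := by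
    funext i
    rw [restrictFin, zeroExt_val_add_one]
  have h0 : ∀ i, ¬ (1 ≤ i ∧ i ≤ (n : ℤ) - 1) → zeroExt z i = 0 := by
    intro i hi
    rw [zeroExt, dif_neg (by omega)]
  have step : ∀ j : ℕ, j < n → zeroExt z ((j : ℤ) + 1) = zeroExt z j := by
    intro j hj
    have := congrFun hz ⟨j, hj⟩
    rw [mulVecLin_apply, hr, isoD_transpose_mulVec h0] at this
    simp only [Pi.zero_apply] at this
    linarith
  have all : ∀ j : ℕ, j ≤ n → zeroExt z j = 0 := by
    intro j
    induction j with
    | zero => intro _; exact h0 _ (by simp)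
    | succ j ih =>
      intro hj
      push_cast
      rw [step j (by omega), ih (by omega)]
  funext i
  have := all (i.val + 1) (by omega)
  push_cast at this
  rwa [zeroExt_val_add_one] at this

theorem posDef_isoM (n : ℕ) : (isoM n).PosDef := by
  have h := Matrix.PosDef.conjTranspose_mul_self (isoD n)ᵀ (isoD_transpose_mulVec_injective n)
  rwa [conjTranspose_eq_transpose_of_trivial, transpose_transpose] at h

/-! ### Contiguous bases -/

theorem mem_interval {n : ℕ} {a b : ℤ} {i : Fin (n - 1)} :
    i ∈ interval n a b ↔ a ≤ (i.val : ℤ) + 1 ∧ (i.val : ℤ) + 1 ≤ b := by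
  simp [interval]

theorem card_interval {n : ℕ} {a b : ℤ} (ha : 1 ≤ a) (hab : a ≤ b + 1) (hb : b ≤ (n : ℤ) - 1) :
    ((interval n a b).card : ℤ) = b - a + 1 := by
  have : (interval n a b).card = (Finset.Icc a b).card := by
    apply Finset.card_bij (fun i _ => (i.val : ℤ) + 1)
    · intro i hi
      rw [mem_interval] at hi
      rwa [Finset.mem_Icc]
    · intro i _ j _ h
      ext
      omega
    · intro l hl
      rw [Finset.mem_Icc] at hl
      refine ⟨⟨(l - 1).toNat, by omega⟩, ?_, ?_⟩
      · rw [mem_interval]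
        simp only
        omega
      · simp only
        omega
  rw [this, Int.card_Icc]
  omega

theorem basisM_mulVec {n : ℕ} {a b : ℤ} (ha : 1 ≤ a) (hb : b ≤ (n : ℤ) - 1) {f : ℤ → ℝ}
    (hf : ∀ i, ¬ (a ≤ i ∧ i ≤ b) → f i = 0) (i : interval n a b) :
    (basisM (interval n a b) *ᵥ fun j => f ((j.1.val : ℤ) + 1)) i
      = 2 * f ((i.1.val : ℤ) + 1) - f i.1.val - f ((i.1.val : ℤ) + 2) := by
  rw [← isoM_mulVec (fun i hi => hf i (by omega))]
  simp only [mulVec, dotProduct, basisM, submatrix_apply, restrictFin]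
  rw [← Finset.sum_subset (Finset.subset_univ (interval n a b)),
    ← Finset.sum_coe_sort (interval n a b)]
  intro j _ hj
  rw [mem_interval] at hj
  rw [hf _ hj, mul_zero]

/-- Each column of the kernel solves the Dirichlet problem with a unit source. For square matrices
this right inverse yields both invertibility and the formula for the inverse. -/
theorem basisM_mul_green {n : ℕ} {a b : ℤ} (ha : 1 ≤ a) (hb : b ≤ (n : ℤ) - 1) :
    basisM (interval n a b) *
      (Matrix.of fun i j => green a b ((j.1.val : ℤ) + 1) ((i.1.val : ℤ) + 1)) = 1 := by
  ext i j
  have hi := mem_interval.mp i.2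
  have hj := mem_interval.mp j.2
  have hg := solvesPoisson_green hj.1 hj.2
  have e := basisM_mulVec ha hb hg.1 i
  have e2 := hg.2 _ hi.1 hi.2
  rw [add_sub_cancel_right, show (i.1.val : ℤ) + 1 + 1 = i.1.val + 2 by ring] at e2
  rw [e2] at e
  rw [mul_apply_eq_vecMul, one_apply]
  simp only [mulVec] at e
  simp only [vecMul]
  refine Eq.trans ?_ (e.trans ?_)
  · rfl
  · by_cases h : i = j
    · rw [if_pos h, if_pos (by rw [h])]
    · rw [if_neg h, if_neg]
      intro h'
      exact h (Subtype.ext (Fin.ext (by omega)))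

theorem isUnit_det_basisM {n : ℕ} {a b : ℤ} (ha : 1 ≤ a) (hb : b ≤ (n : ℤ) - 1) :
    IsUnit (basisM (interval n a b)).det :=
  isUnit_det_of_right_inverse (basisM_mul_green ha hb)

theorem inv_basisM_apply {n : ℕ} {a b : ℤ} (ha : 1 ≤ a) (hb : b ≤ (n : ℤ) - 1)
    (i j : interval n a b) :
    (basisM (interval n a b))⁻¹ i j = green a b ((j.1.val : ℤ) + 1) ((i.1.val : ℤ) + 1) := by
  rw [inv_eq_right_inv (basisM_mul_green ha hb), of_apply]

/-- The right-hand side of the parametric equations, `-(q + lam d)`. -/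
noncomputable def paramRhs {n : ℕ} (k : ℕ) (x0 : Fin n → ℝ) (lam : ℝ) (i : ℤ) : ℝ :=
  -extDiff x0 i + lam * if i = k then 1 else 0

/-- The bridge between the two languages: the right-hand side equals `M_ξξ` applied to `f`, so the
inverse returns `f`. Afterwards basic solutions are handled only through their difference equation.
-/
theorem basicSolution_interval {n k : ℕ} {x0 : Fin n → ℝ} {a b : ℤ} (ha : 1 ≤ a)
    (hb : b ≤ (n : ℤ) - 1) {lam : ℝ} {f : ℤ → ℝ}
    (hf : SolvesPoisson a b (paramRhs k x0 lam) f) :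
    basicSolution k x0 (interval n a b) lam = restrictFin (n - 1) f := by
  funext i
  rw [restrictFin, basicSolution]
  split_ifs with h
  · have : (fun j : interval n a b => -(plcpQ x0 j.1 + lam * plcpD n k j.1)) =
        basisM (interval n a b) *ᵥ fun j => f ((j.1.val : ℤ) + 1) := by
      funext j
      have hj := mem_interval.mp j.2
      have e := hf.2 _ hj.1 hj.2
      rw [basisM_mulVec ha hb hf.1, plcpD_apply, plcpQ, isoD_mulVec_zeroExt]
      rw [add_sub_cancel_right, show (j.1.val : ℤ) + 1 + 1 = j.1.val + 2 by ring] at e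
      rw [e, paramRhs]
      split_ifs <;> ring
    rw [this, mulVec_mulVec, nonsing_inv_mul _ (isUnit_det_basisM ha hb), one_mulVec]
  · rw [mem_interval] at h
    rw [hf.1 _ h]

theorem basicSolution_empty {n : ℕ} (k : ℕ) (x0 : Fin n → ℝ) (lam : ℝ) :
    basicSolution k x0 ∅ lam = 0 := by
  funext i
  simp [basicSolution]

/-- Only row `k` of `q + lam d` depends on `lam`, with value `q_k - lam`. For `k = n` there is no
such row, hence the guarded hypothesis. -/
theorem isLCPSolution_zero {n k : ℕ} {x0 : Fin n → ℝ} (hx : Antitone x0)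
    {lam : ℝ} (hl : k < n → lam ≤ extDiff x0 k) :
    IsLCPSolution (isoM n) (plcpQ x0 + lam • plcpD n k) (basicSolution k x0 ∅ lam) := by
  rw [basicSolution_empty]
  refine ⟨fun i => le_rfl, fun i => ?_, by simp⟩
  have hi := i.isLt
  rw [mulVec_zero, zero_add, plcpQ_add_smul_apply]
  have := extDiff_nonneg hx (j := (i.val : ℤ) + 1) (by omega) (by omega)
  split_ifs with h
  · rw [h]
    linarith [hl (by omega)]
  · linarith

/-- The basic solution solves the LCP if it is nonnegative and the rows of the two neighbours of the
basis are nonnegative. -/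
theorem isLCPSolution_interval {n k : ℕ} {x0 : Fin n → ℝ} (hx : Antitone x0) {a b : ℤ}
    (ha : 1 ≤ a) (hak : a ≤ k) (hkb : k ≤ b) (hb : b ≤ (n : ℤ) - 1) {lam : ℝ} {f : ℤ → ℝ}
    (hf : SolvesPoisson a b (paramRhs k x0 lam) f) (hpos : ∀ i, 0 ≤ f i)
    (hl : 2 ≤ a → f a ≤ extDiff x0 (a - 1)) (hr : b + 2 ≤ n → f b ≤ extDiff x0 (b + 1)) :
    IsLCPSolution (isoM n) (plcpQ x0 + lam • plcpD n k)
      (basicSolution k x0 (interval n a b) lam) := by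
  rw [basicSolution_interval ha hb hf]
  have hrow : ∀ i : Fin (n - 1),
      (isoM n *ᵥ restrictFin (n - 1) f + (plcpQ x0 + lam • plcpD n k)) i
        = 2 * f ((i.val : ℤ) + 1) - f i.val - f ((i.val : ℤ) + 2)
          - paramRhs k x0 lam ((i.val : ℤ) + 1) := by
    intro i
    rw [Pi.add_apply, isoM_mulVec (fun i hi => hf.1 i (by omega)), plcpQ_add_smul_apply, paramRhs]
    ring
  have hin : ∀ i : Fin (n - 1), a ≤ (i.val : ℤ) + 1 → (i.val : ℤ) + 1 ≤ b →
      (isoM n *ᵥ restrictFin (n - 1) f + (plcpQ x0 + lam • plcpD n k)) i = 0 := by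
    intro i h1 h2
    have e := hf.2 _ h1 h2
    rw [add_sub_cancel_right, show (i.val : ℤ) + 1 + 1 = i.val + 2 by ring] at e
    rw [hrow, e, sub_self]
  refine ⟨fun i => hpos _, fun i => ?_, ?_⟩
  · by_cases h : a ≤ (i.val : ℤ) + 1 ∧ (i.val : ℤ) + 1 ≤ b
    · exact (hin i h.1 h.2).ge
    · have hi := i.isLt
      have hq := extDiff_nonneg hx (j := (i.val : ℤ) + 1) (by omega) (by omega)
      rw [hrow, hf.1 _ h, paramRhs, if_neg (by omega)]
      -- Off the basis a row is `q` minus the adjacent values of `f`. These are zero unless the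
      -- index is the left or the right neighbour, where `hl` or `hr` applies.
      by_cases h1 : (i.val : ℤ) + 2 = a
      · have := hl (by omega)
        rw [show a - 1 = (i.val : ℤ) + 1 by omega] at this
        rw [hf.1 i.val (by omega), h1]
        linarith
      · by_cases h2 : (i.val : ℤ) = b
        · have := hr (by omega)
          rw [hf.1 ((i.val : ℤ) + 2) (by omega), h2]
          rw [← h2] at this ⊢
          linarith
        · rw [hf.1 ((i.val : ℤ) + 2) (by omega), hf.1 i.val (by omega)]
          linarith
  · rw [dotProduct]
    apply Finset.sum_eq_zero
    intro i _
    by_cases h : a ≤ (i.val : ℤ) + 1 ∧ (i.val : ℤ) + 1 ≤ b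
    · rw [hin i h.1 h.2, zero_mul]
    · rw [restrictFin, hf.1 _ h, mul_zero]

/-! ### Optimality -/

/-- A feasible point satisfying the variational inequality is the unique solution. -/
theorem isSortedProjection_of_variational {n k : ℕ} {r : ℝ} {x0 y : Fin n → ℝ}
    (hy : SortedFeasible k r y)
    (h : ∀ x : Fin n → ℝ, SortedFeasible k r x → 0 ≤ (y - x0) ⬝ᵥ (x - y)) :
    IsSortedProjection k r x0 y := by
  refine ⟨hy, fun x hx hne => ?_⟩
  have hv := h x hx
  have hpos : 0 < ∑ i, (x i - y i) ^ 2 := by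
    obtain ⟨i, hi⟩ := Function.ne_iff.mp hne
    apply Finset.sum_pos' (fun i _ => sq_nonneg _)
    exact ⟨i, Finset.mem_univ _, by have := sub_ne_zero.mpr hi; positivity⟩
  -- Expanding the square about `y` leaves the term of the variational inequality and `‖x - y‖²`,
  -- which is positive and gives strictness.
  have hid : ∑ i, (x i - x0 i) ^ 2
      = ∑ i, (y i - x0 i) ^ 2 + 2 * ((y - x0) ⬝ᵥ (x - y)) + ∑ i, (x i - y i) ^ 2 := by
    rw [dotProduct, Finset.mul_sum, ← Finset.sum_add_distrib, ← Finset.sum_add_distrib]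
    apply Finset.sum_congr rfl
    intro i _
    simp only [Pi.sub_apply]
    ring
  rw [projObjective, projObjective, hid]
  linarith

theorem onesVec_dotProduct {n k : ℕ} (x : Fin n → ℝ) :
    onesVec n k ⬝ᵥ x = ∑ i with i.val < k, x i := by
  rw [dotProduct, Finset.sum_filter]
  apply Finset.sum_congr rfl
  intro i _
  simp only [onesVec]
  split_ifs <;> simp

theorem sortedFeasible_iff {n k : ℕ} {r : ℝ} {x : Fin n → ℝ} :
    SortedFeasible k r x ↔ onesVec n k ⬝ᵥ x ≤ r ∧ ∀ i, 0 ≤ (isoD n *ᵥ x) i := by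
  rw [SortedFeasible, onesVec_dotProduct]
  refine and_congr_right fun _ => ⟨fun h i => ?_, fun h i j hij => ?_⟩
  · rw [isoD_mulVec, sub_nonneg]
    exact h _ _ rfl
  · have hj := j.isLt
    have := h ⟨i.val, by omega⟩
    rw [isoD_mulVec, sub_nonneg] at this
    convert this
    exact hij.symm

/-- The Karush-Kuhn-Tucker conditions are sufficient. -/
theorem isSortedProjection_of_kkt {n k : ℕ} {r : ℝ} {x0 y : Fin n → ℝ} {lam : ℝ}
    {z : Fin (n - 1) → ℝ} (hlam : 0 ≤ lam) (hz : ∀ i, 0 ≤ z i)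
    (hy : y = x0 - lam • onesVec n k + (isoD n)ᵀ *ᵥ z)
    (hD : ∀ i, 0 ≤ (isoD n *ᵥ y) i) (hsum : onesVec n k ⬝ᵥ y ≤ r)
    (hcl : lam * (onesVec n k ⬝ᵥ y - r) = 0) (hcz : (isoD n *ᵥ y) ⬝ᵥ z = 0) :
    IsSortedProjection k r x0 y := by
  apply isSortedProjection_of_variational (sortedFeasible_iff.mpr ⟨hsum, hD⟩)
  intro x hx
  obtain ⟨h1, h2⟩ := sortedFeasible_iff.mp hx
  have e1 : y - x0 = (isoD n)ᵀ *ᵥ z - lam • onesVec n k := by rw [hy]; abel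
  have e2 : ((isoD n)ᵀ *ᵥ z) ⬝ᵥ (x - y) = (isoD n *ᵥ x) ⬝ᵥ z - (isoD n *ᵥ y) ⬝ᵥ z := by
    rw [mulVec_transpose, ← dotProduct_mulVec, mulVec_sub, dotProduct_sub, dotProduct_comm z,
      dotProduct_comm z]
  have e3 : 0 ≤ (isoD n *ᵥ x) ⬝ᵥ z :=
    Finset.sum_nonneg fun i _ => mul_nonneg (h2 i) (hz i)
  rw [e1, sub_dotProduct, e2, smul_dotProduct, dotProduct_sub, hcz, smul_eq_mul]
  -- What is left is `(D x) ⬝ z ≥ 0` plus `lam` times `1_k ⬝ y - 1_k ⬝ x`; by complementarity `lam *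
  -- (1_k ⬝ y) = lam * r`, and `1_k ⬝ x ≤ r`.
  nlinarith

/-- The primal point attached to a solution of the LCP. -/
theorem isSortedProjection_of_isLCPSolution {n k : ℕ} {r : ℝ} {x0 y : Fin n → ℝ} {lam : ℝ}
    {z : Fin (n - 1) → ℝ} (hlam : 0 ≤ lam)
    (hz : IsLCPSolution (isoM n) (plcpQ x0 + lam • plcpD n k) z)
    (hy : y = x0 - lam • onesVec n k + (isoD n)ᵀ *ᵥ z) (hsum : onesVec n k ⬝ᵥ y = r) :
    IsSortedProjection k r x0 y := by
  have e : isoD n *ᵥ y = isoM n *ᵥ z + (plcpQ x0 + lam • plcpD n k) := by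
    rw [hy, mulVec_add, mulVec_sub, mulVec_smul, mulVec_mulVec, ← isoM, plcpQ, plcpD, smul_neg]
    abel
  obtain ⟨h1, h2, h3⟩ := hz
  exact isSortedProjection_of_kkt hlam h1 hy (by rwa [e]) hsum.le
    (by rw [hsum, sub_self, mul_zero]) (by rwa [e])

/-- Moving `D` to the other factor leaves `D 1_k`, the unit vector at `k`. Hence the budget of the
primal point is `s - k lam + z_k`. -/
theorem onesVec_dotProduct_isoD_transpose {n k : ℕ} (hk : 1 ≤ k) (hkn : k + 1 ≤ n) {f : ℤ → ℝ} :
    onesVec n k ⬝ᵥ ((isoD n)ᵀ *ᵥ restrictFin (n - 1) f) = f k := by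
  rw [mulVec_transpose, dotProduct_comm, ← dotProduct_mulVec, dotProduct]
  have : ∀ i : Fin (n - 1), restrictFin (n - 1) f i * (isoD n *ᵥ onesVec n k) i
      = if (i.val : ℤ) + 1 = k then f ((i.val : ℤ) + 1) else 0 := by
    intro i
    have := plcpD_apply n k i
    rw [plcpD, Pi.neg_apply] at this
    rw [← neg_neg ((isoD n *ᵥ onesVec n k) i), this, restrictFin]
    split_ifs <;> simp
  rw [Finset.sum_congr rfl (fun i _ => this i), sum_ite_val_eq]
  intro h
  omega

theorem onesVec_dotProduct_self {n k : ℕ} (hkn : k ≤ n) : onesVec n k ⬝ᵥ onesVec n k = k := by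
  rw [onesVec_dotProduct, Finset.sum_congr rfl (g := fun _ => (1 : ℝ))]
  · rw [Finset.sum_const, nsmul_eq_mul, mul_one, Fin.card_filter_val_lt, min_eq_right hkn]
  · intro i hi
    rw [Finset.mem_filter] at hi
    rw [onesVec, if_pos hi.2]

/-! ### Evaluation and cost of expressions -/

section Eval

variable (σ : State) (e e' : IExpr) (f f' : RExpr)

@[simp] theorem IExpr.eval_add : (e + e').eval σ = e.eval σ + e'.eval σ := rfl
@[simp] theorem IExpr.eval_sub : (e - e').eval σ = e.eval σ - e'.eval σ := rfl
@[simp] theorem IExpr.eval_zero : (0 : IExpr).eval σ = 0 := rfl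
@[simp] theorem IExpr.eval_one : (1 : IExpr).eval σ = 1 := rfl
@[simp] theorem IExpr.eval_two : (2 : IExpr).eval σ = 2 := rfl
@[simp] theorem IExpr.eval_var (v : IVar) : (IExpr.var v).eval σ = σ.int v := rfl
@[simp] theorem RExpr.eval_add : (f + f').eval σ = f.eval σ + f'.eval σ := rfl
@[simp] theorem RExpr.eval_sub : (f - f').eval σ = f.eval σ - f'.eval σ := rfl
@[simp] theorem RExpr.eval_mul : (f * f').eval σ = f.eval σ * f'.eval σ := rfl
@[simp] theorem RExpr.eval_div : (f / f').eval σ = f.eval σ / f'.eval σ := rfl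
@[simp] theorem RExpr.eval_neg : (-f).eval σ = -f.eval σ := rfl
@[simp] theorem RExpr.eval_min : (RExpr.min f f').eval σ = Min.min (f.eval σ) (f'.eval σ) := rfl
@[simp] theorem RExpr.eval_zero : (0 : RExpr).eval σ = 0 := Nat.cast_zero
@[simp] theorem RExpr.eval_two : (2 : RExpr).eval σ = 2 := by
  change ((2 : ℤ) : ℝ) = 2
  norm_num
@[simp] theorem RExpr.eval_var (v : RVar) : (RExpr.var v).eval σ = σ.real v := rfl
@[simp] theorem RExpr.eval_ofInt : (RExpr.ofInt e).eval σ = ((e.eval σ : ℤ) : ℝ) := rfl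
@[simp] theorem RExpr.eval_get (A : Arr) : (RExpr.get A e).eval σ = σ.arr A (e.eval σ) := rfl

@[simp] theorem qAt_eval :
    (qAt e).eval σ = σ.arr .x (e.eval σ) - σ.arr .x (e.eval σ + 1) := rfl

@[simp] theorem basisSize_eval : basisSize.eval σ = σ.int .b - σ.int .a + 1 := rfl

@[simp] theorem State.int_setI (v w : IVar) (z : ℤ) :
    (σ.setI v z).int w = if w = v then z else σ.int w := by
  simp [State.setI, Function.update_apply]
@[simp] theorem State.real_setI (v : IVar) (z : ℤ) : (σ.setI v z).real = σ.real := rfl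
@[simp] theorem State.arr_setI (v : IVar) (z : ℤ) : (σ.setI v z).arr = σ.arr := rfl
@[simp] theorem State.int_setR (v : RVar) (z : ℝ) : (σ.setR v z).int = σ.int := rfl
@[simp] theorem State.real_setR (v w : RVar) (z : ℝ) :
    (σ.setR v z).real w = if w = v then z else σ.real w := by
  simp [State.setR, Function.update_apply]
@[simp] theorem State.arr_setR (v : RVar) (z : ℝ) : (σ.setR v z).arr = σ.arr := rfl
@[simp] theorem State.int_put (A : Arr) (i : ℤ) (z : ℝ) : (σ.put A i z).int = σ.int := rfl
@[simp] theorem State.real_put (A : Arr) (i : ℤ) (z : ℝ) : (σ.put A i z).real = σ.real := rfl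
@[simp] theorem State.arr_put (A B : Arr) (i j : ℤ) (z : ℝ) :
    (σ.put A i z).arr B j = if B = A ∧ j = i then z else σ.arr B j := by
  by_cases h : B = A
  · subst h
    simp [State.put, Function.update_apply]
  · simp [State.put, h]
@[simp] theorem State.arr_x_put_y (i : ℤ) (z : ℝ) : (σ.put .y i z).arr .x = σ.arr .x := by
  simp [State.put]

end Eval

/-! ### Total correctness with cost -/

/-- Started in `σ`, the program `p` halts in a state and with a cost that satisfy `Q`. -/
def WP (p : Stmt) (σ : State) (Q : ℕ → State → Prop) : Prop := ∃ c σ', Exec p σ c σ' ∧ Q c σ'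

theorem WP.mono {p : Stmt} {σ : State} {Q Q' : ℕ → State → Prop} (h : WP p σ Q)
    (hQ : ∀ c σ', Q c σ' → Q' c σ') : WP p σ Q' := by
  obtain ⟨c, σ', h1, h2⟩ := h
  exact ⟨c, σ', h1, hQ _ _ h2⟩

section WPRules

variable {σ : State} {Q : ℕ → State → Prop}

/-- The rules for loop-free statements are equivalences, so rewriting with them executes such code
symbolically and accumulates its cost. -/
theorem wp_skip : WP .skip σ Q ↔ Q 0 σ :=
  ⟨fun ⟨_, _, h, h'⟩ => by cases h; exact h', fun h => ⟨_, _, .skip _, h⟩⟩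

theorem wp_setI {v : IVar} {e : IExpr} :
    WP (.setI v e) σ Q ↔ Q (e.cost + 1) (σ.setI v (e.eval σ)) :=
  ⟨fun ⟨_, _, h, h'⟩ => by cases h; exact h', fun h => ⟨_, _, .setI _ _ _, h⟩⟩

theorem wp_setR {v : RVar} {e : RExpr} :
    WP (.setR v e) σ Q ↔ Q (e.cost + 1) (σ.setR v (e.eval σ)) :=
  ⟨fun ⟨_, _, h, h'⟩ => by cases h; exact h', fun h => ⟨_, _, .setR _ _ _, h⟩⟩

theorem wp_put {A : Arr} {e : IExpr} {f : RExpr} :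
    WP (.put A e f) σ Q ↔ Q (e.cost + f.cost + 1) (σ.put A (e.eval σ) (f.eval σ)) :=
  ⟨fun ⟨_, _, h, h'⟩ => by cases h; exact h', fun h => ⟨_, _, .put _ _ _ _, h⟩⟩

theorem wp_seq {p p' : Stmt} :
    WP (p ;; p') σ Q ↔ WP p σ fun c σ' => WP p' σ' fun c' σ'' => Q (c + c') σ'' := by
  constructor
  · rintro ⟨_, _, h, h'⟩
    cases h with
    | seq h1 h2 => exact ⟨_, _, h1, _, _, h2, h'⟩
  · rintro ⟨_, _, h1, _, _, h2, h'⟩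
    exact ⟨_, _, .seq h1 h2, h'⟩

theorem wp_ite {b : Test} {p p' : Stmt} :
    WP (.ite b p p') σ Q ↔
      (b.holds σ → WP p σ fun c σ' => Q (b.cost + 1 + c) σ') ∧
      (¬ b.holds σ → WP p' σ fun c σ' => Q (b.cost + 1 + c) σ') := by
  constructor
  · rintro ⟨_, _, h, h'⟩
    cases h with
    | iteTrue hb h => exact ⟨fun _ => ⟨_, _, h, h'⟩, fun hn => absurd hb hn⟩
    | iteFalse hb h => exact ⟨fun hn => absurd hn hb, fun _ => ⟨_, _, h, h'⟩⟩
  · rintro ⟨h1, h2⟩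
    by_cases hb : b.holds σ
    · obtain ⟨_, _, h, h'⟩ := h1 hb
      exact ⟨_, _, .iteTrue hb h, h'⟩
    · obtain ⟨_, _, h, h'⟩ := h2 hb
      exact ⟨_, _, .iteFalse hb h, h'⟩

/-- `I i` describes the state before iteration `i`, with the counter already set. An iteration pays
`hi.cost + 3` for the test, at most `B` for the body and `4` for the increment; the constant part is
the initial assignment and the failing test. -/
theorem wp_forLoop {v : IVar} {lo hi : IExpr} {p : Stmt} {H l : ℤ} {B : ℕ}
    (I : ℤ → State → Prop) (hl : lo.eval σ = l) (h0 : I l (σ.setI v l))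
    (hH : ∀ i σ', I i σ' → σ'.int v = i ∧ hi.eval σ' = H)
    (hstep : ∀ i σ', l ≤ i → i ≤ H → I i σ' →
      WP p σ' fun c σ'' => c ≤ B ∧ σ''.int v = i ∧ I (i + 1) (σ''.setI v (i + 1)))
    (hle : l ≤ H + 1) :
    WP (forLoop v lo hi p) σ fun c σ' =>
      c ≤ (lo.cost + hi.cost + 4) + (B + hi.cost + 7) * (H + 1 - l).toNat ∧ I (H + 1) σ' := by
  have key : ∀ (m : ℕ) (i : ℤ) (σ' : State), l ≤ i → i + m = H + 1 → I i σ' →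
      WP (.while (.ile v hi) (p ;; .setI v (v + (1 : IExpr)))) σ' fun c σ'' =>
        c ≤ (hi.cost + 3) + (B + hi.cost + 7) * m ∧ I (H + 1) σ'' := by
    intro m
    induction m with
    | zero =>
      intro i σ' _ hi' hI
      obtain ⟨h1, h2⟩ := hH i σ' hI
      refine ⟨_, _, .whileDone ?_, ?_, ?_⟩
      · simp only [Test.holds, IExpr.eval_var, h1, h2]
        omega
      · simp only [Test.cost, IExpr.cost]
        omega
      · convert hI using 1
        omega
    | succ m ih =>
      intro i σ' hli hi' hI
      push_cast at hi'
      obtain ⟨h1, h2⟩ := hH i σ' hI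
      obtain ⟨c, σ'', hp, hc, hv, hI'⟩ := hstep i σ' hli (by omega) hI
      obtain ⟨c', σ₂, hw, hc', hI₂⟩ := ih (i + 1) _ (by omega) (by omega) hI'
      have hset := Exec.setI σ'' v (v + (1 : IExpr))
      rw [IExpr.eval_add, IExpr.eval_var, IExpr.eval_one, hv] at hset
      refine ⟨_, _, .whileStep ?_ (.seq hp hset) hw, ?_, hI₂⟩
      · simp only [Test.holds, IExpr.eval_var, h1, h2]
        omega
      · have e : IExpr.cost (v + (1 : IExpr)) = 3 := rfl
        rw [e]
        simp only [Test.cost, IExpr.cost]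
        rw [mul_add]
        omega
  rw [forLoop, wp_seq, wp_setI, hl]
  refine (key (H + 1 - l).toNat l _ le_rfl (by omega) h0).mono fun c σ' h => ⟨?_, h.2⟩
  have := h.1
  omega

/-- A loop that fills a segment of the output array. -/
theorem wp_forLoop_put {lo hi : IExpr} {f : RExpr} {H l : ℤ} {F : ℤ → ℝ}
    (hl : lo.eval σ = l) (hle : l ≤ H + 1)
    (hH : ∀ σ' : State, (∀ w, w ≠ .i → σ'.int w = σ.int w) → hi.eval σ' = H)
    (hF : ∀ σ' : State, σ'.real = σ.real → σ'.arr .x = σ.arr .x → f.eval σ' = F (σ'.int .i)) :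
    WP (forLoop .i lo hi (.put .y IVar.i f)) σ fun c σ' =>
      c ≤ (lo.cost + hi.cost + 4) + (f.cost + hi.cost + 9) * (H + 1 - l).toNat ∧
      (∀ w, w ≠ .i → σ'.int w = σ.int w) ∧ σ'.real = σ.real ∧ σ'.arr .x = σ.arr .x ∧
      ∀ j, σ'.arr .y j = if l ≤ j ∧ j ≤ H then F j else σ.arr .y j := by
  have h := wp_forLoop (v := .i) (hi := hi) (H := H) (B := f.cost + 2) (p := .put .y IVar.i f)
    (fun i σ' => σ'.int .i = i ∧ (∀ w, w ≠ .i → σ'.int w = σ.int w) ∧ σ'.real = σ.real ∧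
      σ'.arr .x = σ.arr .x ∧ ∀ j, σ'.arr .y j = if l ≤ j ∧ j < i then F j else σ.arr .y j)
    hl ?_ (fun i σ' h => ⟨h.1, hH σ' h.2.1⟩) ?_ hle
  · refine h.mono fun c σ' h => ⟨?_, h.2.2.1, h.2.2.2.1, h.2.2.2.2.1, ?_⟩
    · have := h.1
      rwa [show f.cost + 2 + hi.cost + 7 = f.cost + hi.cost + 9 by ring] at this
    · intro j
      rw [h.2.2.2.2.2]
      simp only [Int.lt_add_one_iff]
  · refine ⟨by simp, fun w hw => by simp [hw], rfl, rfl, fun j => ?_⟩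
    rw [if_neg (by omega)]
    rfl
  · rintro i σ' h1 - ⟨h2, h3, h4, h5, h6⟩
    rw [wp_put]
    refine ⟨by simp only [IExpr.cost]; omega, h2, by simp, fun w hw => by simp [hw, h3], h4, ?_, ?_⟩
    · simp [h5]
    · intro j
      rw [State.arr_setI, State.arr_put, hF σ' h4 h5, IExpr.eval_var, h2, h6]
      by_cases hj : j = i
      · subst hj
        simp [h1]
      · simp only [hj, and_false, if_false]
        congr 1
        apply propext
        omega

end WPRules

/-! ### The parts of the program outside the main loop -/

theorem writeShifted_spec {σ : State} {n k : ℕ} (hk : k ≤ n) (hn : σ.int .n = n)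
    (hki : σ.int .k = k) :
    WP writeShifted σ fun c σ' => c ≤ 18 * n + 18 ∧ (∀ w, w ≠ .i → σ'.int w = σ.int w) ∧
      σ'.real = σ.real ∧ σ'.arr .x = σ.arr .x ∧
      ∀ j : ℤ, 1 ≤ j → j ≤ n →
        σ'.arr .y j = σ.arr .x j - if j ≤ k then σ.real .lbar else 0 := by
  rw [writeShifted, wp_seq]
  refine (wp_forLoop_put (H := k) (l := 1) (F := fun j => σ.arr .x j - σ.real .lbar) rfl (by omega)
    (fun σ' h => by simp [h, hki]) (fun σ' h1 h2 => by simp [h1, h2])).mono ?_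
  rintro c σ' ⟨hc, hi, hr, hx, hy⟩
  refine (wp_forLoop_put (H := n) (l := k + 1) (F := fun j => σ.arr .x j) (by simp [hi, hki])
    (by omega) (fun σ'' h => by simp [h, hi, hn]) (fun σ'' h1 h2 => by simp [h2, hx])).mono ?_
  rintro c' σ'' ⟨hc', hi', hr', hx', hy'⟩
  refine ⟨?_, fun w hw => by rw [hi' w hw, hi w hw], by rw [hr', hr], by rw [hx', hx], ?_⟩
  · have e1 : IExpr.cost (1 : IExpr) = 1 := rfl
    have e2 : IExpr.cost (IVar.k + (1 : IExpr)) = 3 := rfl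
    have e3 : RExpr.cost (.get .x IVar.i - RVar.lbar) = 4 := rfl
    have e4 : RExpr.cost (.get .x IVar.i) = 2 := rfl
    rw [e1, e3] at hc
    rw [e2, e4] at hc'
    simp only [IExpr.cost] at hc hc'
    omega
  · intro j h1 h2
    rw [hy', hy]
    split_ifs <;> first | omega | simp

/-- Summation by parts: the weighted sum of negated second differences telescopes to `(m + 1) f a`,
so division by `m + 1` gives `f a = f a - f (a - 1)`, the first increment. Subtracting the
right-hand side at `j` then turns the increment of `f` ending at `j` into the next one. -/
theorem addDTz_spec {σ : State} {n k : ℕ} {x0 : Fin n → ℝ} {a b : ℤ} {f : ℤ → ℝ}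
    (hak : a ≤ k) (hkb : k ≤ b) (hai : σ.int .a = a) (hbi : σ.int .b = b)
    (hpk : σ.int .pk = k + 1 - a) (hx : σ.arr .x = zeroExt x0)
    (hf : SolvesPoisson a b (paramRhs k x0 (σ.real .lbar)) f) :
    WP addDTz σ fun c σ' => c ≤ 200 * (b - a + 1).toNat + 100 ∧
      ∀ j, σ'.arr .y j = σ.arr .y j + (f j - f (j - 1)) := by
  obtain ⟨m, hm⟩ : ∃ m : ℤ, m = b - a + 1 := ⟨_, rfl⟩
  rw [addDTz, wp_seq, wp_setI, wp_seq, wp_setR, wp_seq]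
  have loop1 := wp_forLoop (σ := (σ.setI .m (basisSize.eval σ)).setR .c ((0 : RExpr).eval
      (σ.setI .m (basisSize.eval σ)))) (v := .i) (hi := IVar.m) (lo := 1) (H := m) (B := 60) (l := 1)
    (p := .setI .j (IVar.b - IVar.i + (1 : IExpr)) ;;
     .setR .c (RVar.c + .ofInt IVar.i * -qAt IVar.j) ;;
     .ite (.ieq (IVar.m - IVar.i + (1 : IExpr)) IVar.pk)
       (.setR .c (RVar.c + .ofInt IVar.i * RVar.lbar)) .skip)
    (fun i σ' => σ'.int .i = i ∧ σ'.int .m = m ∧ σ'.int .a = a ∧ σ'.int .b = b ∧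
      σ'.int .pk = k + 1 - a ∧ σ'.real .lbar = σ.real .lbar ∧ σ'.arr = σ.arr ∧
      -- The loop runs from `b` down to `a`. The expression is zero at `i = 1` because `f (b + 1) =
      -- 0`, and equals `(m + 1) f a` at `i = m + 1` because `f (a - 1) = 0`.
      σ'.real .c = i * f (b + 2 - i) - (i - 1) * f (b + 1 - i)) rfl ?_ ?_ ?_ (by omega)
  · refine loop1.mono ?_
    rintro c σ' ⟨hc, -, h2, h3, h4, h5, h6, h7, h8⟩
    rw [wp_seq, wp_setR, wp_seq, wp_put]
    rw [show b + 1 - (m + 1) = a - 1 by omega, show b + 2 - (m + 1) = a by omega,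
      hf.1 (a - 1) (by omega)] at h8
    have loop2 := wp_forLoop (σ := (σ'.setR .c
        ((RVar.c / .ofInt (IVar.m + (1 : IExpr)) : RExpr).eval σ')).put .y
        ((IVar.a : IExpr).eval (σ'.setR .c
          ((RVar.c / .ofInt (IVar.m + (1 : IExpr)) : RExpr).eval σ')))
        ((RExpr.get .y IVar.a + RVar.c : RExpr).eval (σ'.setR .c
          ((RVar.c / .ofInt (IVar.m + (1 : IExpr)) : RExpr).eval σ')))) (v := .i)
      (lo := 2) (hi := IVar.m + (1 : IExpr)) (H := m + 1) (B := 60) (l := 2)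
      (p := .setI .j (IVar.a + IVar.i - (2 : IExpr)) ;;
       .setR .c (RVar.c - -qAt IVar.j) ;;
       .ite (.ieq (IVar.i - (1 : IExpr)) IVar.pk) (.setR .c (RVar.c - RVar.lbar)) .skip ;;
       .put .y (IVar.j + (1 : IExpr)) (.get .y (IVar.j + (1 : IExpr)) + RVar.c))
      (fun i ρ => ρ.int .i = i ∧ ρ.int .m = m ∧ ρ.int .a = a ∧
        ρ.int .pk = k + 1 - a ∧ ρ.real .lbar = σ.real .lbar ∧ ρ.arr .x = σ.arr .x ∧
        -- Before iteration `i` the register holds the increment last written, and coordinates up to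
        -- `a + i - 2` are finished; the last iteration writes coordinate `b + 1`.
        ρ.real .c = f (a + i - 2) - f (a + i - 3) ∧
        ∀ l, ρ.arr .y l = σ.arr .y l + if l < a + i - 1 then f l - f (l - 1) else 0) rfl ?_ ?_ ?_
      (by omega)
    · refine loop2.mono ?_
      rintro c' ρ ⟨hc', -, -, -, -, -, -, -, hy⟩
      refine ⟨?_, fun j => ?_⟩
      · have e1 : IExpr.cost (1 : IExpr) = 1 := rfl
        have e2 : IExpr.cost (2 : IExpr) = 1 := rfl
        have e3 : IExpr.cost (IVar.m + (1 : IExpr)) = 3 := rfl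
        have e4 : IExpr.cost basisSize = 5 := rfl
        have e5 : RExpr.cost (0 : RExpr) = 1 := rfl
        have e6 : RExpr.cost (RVar.c / .ofInt (IVar.m + (1 : IExpr))) = 6 := rfl
        have e7 : RExpr.cost (RExpr.get .y IVar.a + RVar.c) = 4 := rfl
        rw [e1] at hc
        rw [e2, e3] at hc'
        rw [e4, e5, e6, e7]
        simp only [IExpr.cost] at hc hc' ⊢
        omega
      · rw [hy]
        split_ifs with h
        · rfl
        · rw [hf.1 j (by omega), hf.1 (j - 1) (by omega), sub_zero]
    · have hm0 : (m : ℝ) + 1 ≠ 0 := by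
        have : (0 : ℝ) ≤ m := by exact_mod_cast (by omega : (0 : ℤ) ≤ m)
        positivity
      refine ⟨by simp, by simp [h2], by simp [h3], by simp [h5], by simp [h6], by simp [h7], ?_, ?_⟩
      · simp only [RExpr.eval_div, RExpr.eval_var, RExpr.eval_ofInt, h2, h8, IExpr.eval,
          State.real_setI, State.real_put,
          State.real_setR, if_true]
        rw [show a + 2 - 2 = a by ring, show a + 2 - 3 = a - 1 by ring, hf.1 (a - 1) (by omega)]
        push_cast
        field_simp
        ring
      · intro l
        simp only [RExpr.eval_div, RExpr.eval_var, RExpr.eval_ofInt, IExpr.eval_add,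
          IExpr.eval_var, IExpr.eval_one, h2, h3, h7, h8, State.arr_setI, State.arr_put,
          State.arr_setR, State.int_setR, State.real_setR, RExpr.eval_add, RExpr.eval_get, if_true,
          true_and]
        by_cases hla : l = a
        · subst hla
          rw [if_pos rfl, if_pos (by omega), hf.1 (l - 1) (by omega)]
          push_cast
          field_simp
          ring
        · rw [if_neg hla]
          split_ifs with h
          · rw [hf.1 l (by omega), hf.1 (l - 1) (by omega)]
            ring
          · ring
    · rintro i ρ ⟨h1, h2, -⟩
      exact ⟨h1, by simp [h2]⟩
    · rintro i ρ hi1 hi2 ⟨g1, g2, g3, g4, g5, g6, g7, g8⟩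
      have e := hf.2 (a + i - 2) (by omega) (by omega)
      rw [show a + i - 2 - 1 = a + i - 3 by ring, paramRhs, extDiff, ← hx] at e
      simp only [wp_seq, wp_setI, wp_setR, wp_ite, wp_put, wp_skip]
      constructor
      · intro ht
        simp [Test.holds, g1, g4] at ht
        refine ⟨by decide, by simp [g1], by simp, by simp [g2], by simp [g3], by simp [g4],
          by simp [g5], by simp [g6], ?_, fun l => ?_⟩
        · simp [g1, g3, g5, g6, g7]
          rw [if_pos (by omega)] at e
          rw [show a + (i + 1) - 2 = a + i - 2 + 1 by ring,
            show a + (i + 1) - 3 = a + i - 2 by ring]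
          linarith
        · simp [g1, g3, g5, g6, g7, g8]
          rw [if_pos (by omega)] at e
          by_cases hl : l = a + i - 2 + 1
          · rw [if_pos hl, if_neg (by omega), if_pos (by omega), hl, add_sub_cancel_right]
            linarith
          · rw [if_neg hl]
            congr 2
            apply propext
            omega
      · intro ht
        simp [Test.holds, g1, g4] at ht
        refine ⟨by decide, by simp [g1], by simp, by simp [g2], by simp [g3], by simp [g4],
          by simp [g5], by simp [g6], ?_, fun l => ?_⟩
        · simp [g1, g3, g6, g7]
          rw [if_neg (by omega)] at e
          rw [show a + (i + 1) - 2 = a + i - 2 + 1 by ring,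
            show a + (i + 1) - 3 = a + i - 2 by ring]
          linarith
        · simp [g1, g3, g6, g7, g8]
          rw [if_neg (by omega)] at e
          by_cases hl : l = a + i - 2 + 1
          · rw [if_pos hl, if_neg (by omega), if_pos (by omega), hl, add_sub_cancel_right]
            linarith
          · rw [if_neg hl]
            congr 2
            apply propext
            omega
  · refine ⟨by simp, by simp [hai, hbi, hm], by simp [hai], by simp [hbi], by simp [hpk], by simp,
      by simp, ?_⟩
    rw [hf.1 (b + 2 - 1) (by omega)]
    simp
  · rintro i ρ ⟨h1, h2, -⟩
    exact ⟨h1, by simp [h2]⟩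
  · rintro i ρ hi1 hi2 ⟨g1, g2, g3, g4, g5, g6, g7, g8⟩
    have e := hf.2 (b - i + 1) (by omega) (by omega)
    rw [paramRhs, extDiff, ← hx, show b - i + 1 - 1 = b + 2 - (i + 1) - 1 by ring,
      show b - i + 1 + 1 = b + 2 - i by ring] at e
    rw [show b + 1 - i = b - i + 1 by ring] at g8
    simp only [wp_seq, wp_setI, wp_setR, wp_ite, wp_skip]
    constructor
    · intro ht
      simp [Test.holds, g1, g2, g5] at ht
      rw [if_pos (by omega)] at e
      refine ⟨by decide, by simp [g1], by simp, by simp [g2], by simp [g3], by simp [g4],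
        by simp [g5], by simp [g6], by simp [g7], ?_⟩
      simp [g1, g4, g6, g7, g8]
      rw [show b - i + 1 + 1 = b + 2 - i by ring, show b + 2 - (i + 1) = b - i + 1 by ring]
      rw [show b + 2 - (i + 1) - 1 = b - i by ring] at e
      linear_combination (-(i : ℝ)) * e
    · intro ht
      simp [Test.holds, g1, g2, g5] at ht
      rw [if_neg (by omega)] at e
      refine ⟨by decide, by simp [g1], by simp, by simp [g2], by simp [g3], by simp [g4],
        by simp [g5], by simp [g6], by simp [g7], ?_⟩
      simp [g1, g4, g7, g8]
      rw [show b - i + 1 + 1 = b + 2 - i by ring, show b + 2 - (i + 1) = b - i + 1 by ring]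
      rw [show b + 2 - (i + 1) - 1 = b - i by ring] at e
      linear_combination (-(i : ℝ)) * e

/-! ### One pass of the main loop -/

/-- The value of the expression `mInv` for a basis of size `m` at the positions `p` and `p'`. -/
noncomputable def mInvVal (m p p' : ℤ) : ℝ :=
  ((m + 1 - max p p' : ℤ) : ℝ) * ((min p p' : ℤ) : ℝ) / ((m + 1 : ℤ) : ℝ)

@[simp] theorem mInv_eval (σ : State) (c d : IExpr) :
    (mInv c d).eval σ = mInvVal (σ.int .b - σ.int .a + 1) (c.eval σ) (d.eval σ) := rfl

theorem mInvVal_eq_green {a b i j : ℤ} (h1 : a ≤ i) (h2 : i ≤ b) :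
    mInvVal (b - a + 1) (i + 1 - a) (j + 1 - a) = green a b j i := by
  rw [green, if_pos ⟨h1, h2⟩, mInvVal]

theorem mInvVal_one_right {a b i : ℤ} (h1 : a ≤ i) (h2 : i ≤ b) :
    mInvVal (b - a + 1) (i + 1 - a) 1 = green a b a i := by
  rw [← mInvVal_eq_green h1 h2, add_sub_cancel_left]

theorem mInvVal_one_left {a b j : ℤ} (h : a ≤ b) :
    mInvVal (b - a + 1) 1 (j + 1 - a) = green a b j a := by
  rw [← mInvVal_eq_green le_rfl h, add_sub_cancel_left]

theorem green_comm {a b i j : ℤ} (h1 : a ≤ i) (h2 : i ≤ b) (h3 : a ≤ j) (h4 : j ≤ b) :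
    green a b j i = green a b i j := by
  rw [← mInvVal_eq_green h1 h2, ← mInvVal_eq_green h3 h4, mInvVal, mInvVal, max_comm, min_comm]

/-- The parameter at which the row of the left neighbour of the basis vanishes. -/
noncomputable def leftBreakpoint (σ : State) : ℝ :=
  (σ.arr .x (σ.int .a - 1) - σ.arr .x (σ.int .a) - σ.real .za)
    / mInvVal (σ.int .b - σ.int .a + 1) (σ.int .pk) 1

/-- The parameter at which the row of the right neighbour of the basis vanishes. -/
noncomputable def rightBreakpoint (σ : State) : ℝ :=
  (σ.arr .x (σ.int .b + 1) - σ.arr .x (σ.int .b + 1 + 1) - σ.real .zb)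
    / mInvVal (σ.int .b - σ.int .a + 1) (σ.int .pk) (σ.int .pb)

/-- Infinite breakpoints are never stored: `2 ≤ a` and `b + 2 ≤ n` express that a neighbour exists,
and the comparison with an absent one is vacuous. Ties are resolved to the left. -/
theorem nextBreakpoint_spec (σ : State) :
    WP nextBreakpoint σ fun c σ' => c ≤ 120 ∧
      (∀ w, w ≠ .inf → w ≠ .left → σ'.int w = σ.int w) ∧
      (∀ w, w ≠ .lam → w ≠ .lamA → w ≠ .lamB → σ'.real w = σ.real w) ∧ σ'.arr = σ.arr ∧
      ((σ'.int .inf = 1 ∧ ¬ 2 ≤ σ.int .a ∧ ¬ σ.int .b + 2 ≤ σ.int .n) ∨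
       (σ'.int .inf = 0 ∧ σ'.int .left = 1 ∧ 2 ≤ σ.int .a ∧ σ'.real .lam = leftBreakpoint σ ∧
        (σ.int .b + 2 ≤ σ.int .n → leftBreakpoint σ ≤ rightBreakpoint σ)) ∨
       (σ'.int .inf = 0 ∧ σ'.int .left = 0 ∧ σ.int .b + 2 ≤ σ.int .n ∧
        σ'.real .lam = rightBreakpoint σ ∧
        (2 ≤ σ.int .a → rightBreakpoint σ ≤ leftBreakpoint σ))) := by
  simp only [nextBreakpoint, wp_seq, wp_setI, wp_setR, wp_ite, wp_skip]
  have hA : σ.int .a - 1 + 1 = σ.int .a := sub_add_cancel _ _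
  refine ⟨fun h1 => ⟨fun h2 => ⟨fun h3 => ?_, fun h3 => ?_⟩, fun h2 => ?_⟩,
    fun h1 => ⟨fun h2 => ?_, fun h2 => ?_⟩⟩
  · simp [Test.holds, hA] at h1 h2 h3
    refine ⟨by decide, fun w e1 e2 => by simp [e1, e2], fun w e1 e2 e3 => by simp [e1, e2, e3],
      by simp, .inr (.inl ⟨by simp, by simp, h1, ?_, fun _ => h3⟩)⟩
    simp [hA]
    exact min_eq_left h3
  · simp [Test.holds, hA] at h1 h2 h3
    refine ⟨by decide, fun w e1 e2 => by simp [e1, e2], fun w e1 e2 e3 => by simp [e1, e2, e3],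
      by simp, .inr (.inr ⟨by simp, by simp, h2, ?_, fun _ => h3.le⟩)⟩
    simp [hA]
    exact min_eq_right h3.le
  · simp [Test.holds] at h1 h2
    refine ⟨by decide, fun w e1 e2 => by simp [e1, e2], fun w e1 e2 _ => by simp [e1, e2],
      by simp, .inr (.inl ⟨by simp, by simp, h1, ?_, fun h => absurd h (by omega)⟩)⟩
    simp [hA, leftBreakpoint]
  · simp [Test.holds] at h1 h2
    refine ⟨by decide, fun w e1 e2 => by simp [e1, e2], fun w e1 _ e3 => by simp [e1, e3],
      by simp, .inr (.inr ⟨by simp, by simp, h2, ?_, fun h => absurd h (by omega)⟩)⟩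
    simp [rightBreakpoint]
  · simp [Test.holds] at h1 h2
    refine ⟨by decide, fun w e1 e2 => by simp [e1, e2], fun w e1 e2 e3 => by simp,
      by simp, .inl ⟨by simp, by omega, by omega⟩⟩

theorem stopPivoting_spec (σ : State) :
    WP stopPivoting σ fun c σ' => c ≤ 40 ∧ (∀ w, w ≠ .done → σ'.int w = σ.int w) ∧
      σ'.int .done = 1 ∧ σ'.arr = σ.arr ∧ σ'.real .lbar = (σ.real .s - σ.real .r + σ.real .zk)
        / ((σ.int .k : ℝ) - mInvVal (σ.int .b - σ.int .a + 1) (σ.int .pk) (σ.int .pk)) := by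
  simp only [stopPivoting, wp_seq, wp_setI, wp_setR]
  exact ⟨by decide, fun w hw => by simp [hw], by simp, by simp, by simp⟩

/-- The registers after the left neighbour has entered the basis. -/
theorem updateBasis_spec_left {σ : State} (hl : σ.int .left = 1) {z : ℝ}
    (hz : z = (σ.real .za - (σ.arr .x (σ.int .a - 1) - σ.arr .x (σ.int .a))) / σ.real .sig) :
    WP updateBasis σ fun c σ' => c ≤ 150 ∧ σ'.arr = σ.arr ∧
      (∀ w, w ≠ .a → w ≠ .pk → w ≠ .pb → w ≠ .t → σ'.int w = σ.int w) ∧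
      σ'.int .a = σ.int .a - 1 ∧ σ'.int .pk = σ.int .pk + 1 ∧ σ'.int .pb = σ.int .pb + 1 ∧
      σ'.int .t = σ.int .t + 1 ∧
      (∀ w, w ≠ .za → w ≠ .zk → w ≠ .zb → w ≠ .sig → σ'.real w = σ.real w) ∧
      σ'.real .za = z ∧
      σ'.real .zk = σ.real .zk + z * mInvVal (σ.int .b - σ.int .a + 1) (σ.int .pk) 1 ∧
      σ'.real .zb = σ.real .zb + z * mInvVal (σ.int .b - σ.int .a + 1) (σ.int .pb) 1 ∧
      σ'.real .sig = ((σ.int .t + 1 + 2 : ℤ) : ℝ) / ((σ.int .t + 1 + 1 : ℤ) : ℝ) := by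
  simp only [updateBasis, wp_seq, wp_setI, wp_setR, wp_ite]
  refine ⟨fun _ => ?_, fun h => absurd hl (by simpa [Test.holds] using h)⟩
  refine ⟨by decide, by simp, fun w e1 e2 e3 e4 => by simp [e1, e2, e3, e4], by simp, by simp,
    by simp, by simp, fun w e1 e2 e3 e4 => by simp [e1, e2, e3, e4], by simp [hz],
    by simp [hz], by simp [hz], by simp⟩

/-- The registers after the right neighbour has entered the basis. -/
theorem updateBasis_spec_right {σ : State} (hl : σ.int .left = 0) {z : ℝ}
    (hz : z = (σ.real .zb - (σ.arr .x (σ.int .b + 1) - σ.arr .x (σ.int .b + 1 + 1)))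
      / σ.real .sig) :
    WP updateBasis σ fun c σ' => c ≤ 150 ∧ σ'.arr = σ.arr ∧
      (∀ w, w ≠ .b → w ≠ .pb → w ≠ .t → σ'.int w = σ.int w) ∧
      σ'.int .b = σ.int .b + 1 ∧ σ'.int .pb = σ.int .pb + 1 ∧ σ'.int .t = σ.int .t + 1 ∧
      (∀ w, w ≠ .za → w ≠ .zk → w ≠ .zb → w ≠ .sig → σ'.real w = σ.real w) ∧
      σ'.real .zb = z ∧
      σ'.real .za = σ.real .za + z * mInvVal (σ.int .b - σ.int .a + 1) 1 (σ.int .pb) ∧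
      σ'.real .zk =
        σ.real .zk + z * mInvVal (σ.int .b - σ.int .a + 1) (σ.int .pk) (σ.int .pb) ∧
      σ'.real .sig = ((σ.int .t + 1 + 2 : ℤ) : ℝ) / ((σ.int .t + 1 + 1 : ℤ) : ℝ) := by
  simp only [updateBasis, wp_seq, wp_setI, wp_setR, wp_ite]
  refine ⟨fun h => absurd h (by simp [Test.holds, hl]), fun _ => ?_⟩
  refine ⟨by decide, by simp, fun w e1 e2 e3 => by simp [e1, e2, e3], by simp, by simp,
    by simp, fun w e1 e2 e3 e4 => by simp [e1, e2, e3, e4], by simp [hz],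
    by simp [hz], by simp [hz], by simp⟩

/-- The sequence behind the basic solution for `{a, ..., b}` at the parameter `lam`, where `f` is
the one at the parameter zero. -/
noncomputable def solutionPath (a b k : ℤ) (f : ℤ → ℝ) (lam : ℝ) (i : ℤ) : ℝ :=
  f i + lam * green a b k i

/-- Superposition: the parameter contributes `lam` times the unit source at `k`. -/
theorem solvesPoisson_solutionPath {n k : ℕ} {x0 : Fin n → ℝ} {a b : ℤ} {f : ℤ → ℝ}
    (hak : a ≤ k) (hkb : k ≤ b) (hf : SolvesPoisson a b (paramRhs k x0 0) f) (lam : ℝ) :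
    SolvesPoisson a b (paramRhs k x0 lam) (solutionPath a b k f lam) :=
  (hf.add_smul lam (solvesPoisson_green hak hkb)).congr_right fun i _ _ => by simp [paramRhs]

/-- The kernel is nonnegative. This monotonicity is why no index ever has to leave the basis. -/
theorem solutionPath_mono {a b k : ℤ} (hak : a ≤ k) (hkb : k ≤ b) (f : ℤ → ℝ) {lam mu : ℝ}
    (h : lam ≤ mu) (i : ℤ) : solutionPath a b k f lam i ≤ solutionPath a b k f mu i := by
  have := mul_le_mul_of_nonneg_right h (green_nonneg hak hkb i)
  rw [solutionPath, solutionPath]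
  linarith

/-- The rows of the two neighbours of the basis are nonnegative. -/
def NeighboursFeasible {n : ℕ} (x0 : Fin n → ℝ) (a b : ℤ) (f : ℤ → ℝ) : Prop :=
  (2 ≤ a → f a ≤ extDiff x0 (a - 1)) ∧ (b + 2 ≤ n → f b ≤ extDiff x0 (b + 1))

/-- The invariant of the main loop at the start of pass `t`, where `f` extends the basic solution
at the parameter zero. -/
structure LoopInvariant {n : ℕ} (k : ℕ) (r : ℝ) (x0 : Fin n → ℝ) (t : ℕ) (f : ℤ → ℝ)
    (σ : State) : Prop where
  n_eq : σ.int .n = n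
  k_eq : σ.int .k = k
  done_eq : σ.int .done = 0
  ret_eq : σ.int .ret = 0
  -- The register counts the size of the basis, one more than the number of the pass.
  t_eq : σ.int .t = t + 1
  one_le_a : 1 ≤ σ.int .a
  a_le_k : σ.int .a ≤ k
  k_le_b : k ≤ σ.int .b
  b_le : σ.int .b ≤ (n : ℤ) - 1
  size_eq : σ.int .b - σ.int .a = t
  pk_eq : σ.int .pk = k + 1 - σ.int .a
  pb_eq : σ.int .pb = σ.int .b + 1 - σ.int .a
  x_eq : σ.arr .x = zeroExt x0
  r_eq : σ.real .r = r
  s_eq : σ.real .s = onesVec n k ⬝ᵥ x0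
  solves : SolvesPoisson (σ.int .a) (σ.int .b) (paramRhs k x0 0) f
  za_eq : σ.real .za = f (σ.int .a)
  zk_eq : σ.real .zk = f k
  zb_eq : σ.real .zb = f (σ.int .b)
  sig_eq : σ.real .sig = (t + 3) / (t + 2)
  lam_nonneg : 0 ≤ σ.real .lam
  -- The budget is still exceeded at the current breakpoint, so the final parameter lies beyond it.
  budget : r < onesVec n k ⬝ᵥ x0 - k * σ.real .lam
    + solutionPath (σ.int .a) (σ.int .b) k f (σ.real .lam) k
  path_nonneg : ∀ i, 0 ≤ solutionPath (σ.int .a) (σ.int .b) k f (σ.real .lam) i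
  neighbours : NeighboursFeasible x0 (σ.int .a) (σ.int .b)
    (solutionPath (σ.int .a) (σ.int .b) k f (σ.real .lam))

/-- The state after the last pass. -/
structure StopState {n : ℕ} (k : ℕ) (r : ℝ) (x0 : Fin n → ℝ) (f : ℤ → ℝ) (σ σ' : State) :
    Prop where
  done_eq : σ'.int .done = 1
  int_eq : ∀ w, w ≠ .done → w ≠ .inf → w ≠ .left → σ'.int w = σ.int w
  x_eq : σ'.arr .x = zeroExt x0
  lam_le : σ.real .lam ≤ σ'.real .lbar
  budget : onesVec n k ⬝ᵥ x0 - k * σ'.real .lbar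
    + solutionPath (σ.int .a) (σ.int .b) k f (σ'.real .lbar) k = r
  neighbours : NeighboursFeasible x0 (σ.int .a) (σ.int .b)
    (solutionPath (σ.int .a) (σ.int .b) k f (σ'.real .lbar))

/-- The change made by a pass that is not the last one. -/
structure PivotStep {n : ℕ} (k : ℕ) (x0 : Fin n → ℝ) (f : ℤ → ℝ) (σ σ' : State) : Prop where
  lam_le : σ.real .lam ≤ σ'.real .lam
  neighbours : NeighboursFeasible x0 (σ.int .a) (σ.int .b)
    (solutionPath (σ.int .a) (σ.int .b) k f (σ'.real .lam))
  basis : (σ'.int .a = σ.int .a - 1 ∧ σ'.int .b = σ.int .b) ∨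
    (σ'.int .a = σ.int .a ∧ σ'.int .b = σ.int .b + 1)

/-! ### Consequences of the invariant: LCP solutions, breakpoints, stopping. -/

namespace LoopInvariant

variable {n k : ℕ} {r : ℝ} {x0 : Fin n → ℝ} {t : ℕ} {f : ℤ → ℝ} {σ : State}

/-- By monotonicity, nonnegativity is inherited from the left end of the parameter interval, and the
two neighbour rows from its right end. -/
theorem isLCPSolution (h : LoopInvariant k r x0 t f σ) (hx : Antitone x0) {lam mu : ℝ}
    (h1 : σ.real .lam ≤ lam) (h2 : lam ≤ mu)
    (hmu : NeighboursFeasible x0 (σ.int .a) (σ.int .b)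
      (solutionPath (σ.int .a) (σ.int .b) k f mu)) :
    IsLCPSolution (isoM n) (plcpQ x0 + lam • plcpD n k)
      (basicSolution k x0 (σ.basis n) lam) := by
  refine isLCPSolution_interval hx h.one_le_a h.a_le_k h.k_le_b h.b_le
    (solvesPoisson_solutionPath h.a_le_k h.k_le_b h.solves lam) (fun i => ?_)
    (fun ha => ?_) (fun hb => ?_)
  · exact (h.path_nonneg i).trans (solutionPath_mono h.a_le_k h.k_le_b f h1 i)
  · exact (solutionPath_mono h.a_le_k h.k_le_b f h2 _).trans (hmu.1 ha)
  · exact (solutionPath_mono h.a_le_k h.k_le_b f h2 _).trans (hmu.2 hb)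

theorem a_le_b (h : LoopInvariant k r x0 t f σ) : σ.int .a ≤ σ.int .b :=
  h.a_le_k.trans h.k_le_b

theorem sig_eq_schur (h : LoopInvariant k r x0 t f σ) :
    σ.real .sig = 2 - ((σ.int .b : ℝ) - σ.int .a + 1) / (σ.int .b - σ.int .a + 2) := by
  have : (σ.int .b : ℝ) - σ.int .a = t := by exact_mod_cast h.size_eq
  rw [h.sig_eq, this]
  field_simp
  ring

theorem leftBreakpoint_eq (h : LoopInvariant k r x0 t f σ) :
    leftBreakpoint σ = (extDiff x0 (σ.int .a - 1) - f (σ.int .a))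
      / green (σ.int .a) (σ.int .b) k (σ.int .a) := by
  rw [leftBreakpoint, h.x_eq, h.za_eq, h.pk_eq, mInvVal_one_right h.a_le_k h.k_le_b, extDiff,
    sub_add_cancel, green_comm h.a_le_k h.k_le_b le_rfl h.a_le_b]

theorem rightBreakpoint_eq (h : LoopInvariant k r x0 t f σ) :
    rightBreakpoint σ = (extDiff x0 (σ.int .b + 1) - f (σ.int .b))
      / green (σ.int .a) (σ.int .b) k (σ.int .b) := by
  rw [rightBreakpoint, h.x_eq, h.zb_eq, h.pk_eq, h.pb_eq, mInvVal_eq_green h.a_le_k h.k_le_b,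
    extDiff, green_comm h.a_le_k h.k_le_b h.a_le_b le_rfl]

/-- The row of the left neighbour is `q_(a-1) - z_a(mu)`, affine in `mu` with negative slope since
the kernel is positive, and it vanishes at the breakpoint. -/
theorem solutionPath_a_le_iff (h : LoopInvariant k r x0 t f σ) (mu : ℝ) :
    solutionPath (σ.int .a) (σ.int .b) k f mu (σ.int .a) ≤ extDiff x0 (σ.int .a - 1) ↔
      mu ≤ leftBreakpoint σ := by
  rw [h.leftBreakpoint_eq, le_div_iff₀ (green_pos le_rfl h.a_le_b h.a_le_k h.k_le_b), solutionPath,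
    le_sub_iff_add_le']

theorem solutionPath_b_le_iff (h : LoopInvariant k r x0 t f σ) (mu : ℝ) :
    solutionPath (σ.int .a) (σ.int .b) k f mu (σ.int .b) ≤ extDiff x0 (σ.int .b + 1) ↔
      mu ≤ rightBreakpoint σ := by
  rw [h.rightBreakpoint_eq, le_div_iff₀ (green_pos h.a_le_b le_rfl h.a_le_k h.k_le_b),
    solutionPath, le_sub_iff_add_le']

theorem solutionPath_leftBreakpoint (h : LoopInvariant k r x0 t f σ) :
    solutionPath (σ.int .a) (σ.int .b) k f (leftBreakpoint σ) (σ.int .a)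
      = extDiff x0 (σ.int .a - 1) := by
  have := (green_pos le_rfl h.a_le_b h.a_le_k h.k_le_b).ne'
  rw [h.leftBreakpoint_eq, solutionPath]
  field_simp
  ring

theorem solutionPath_rightBreakpoint (h : LoopInvariant k r x0 t f σ) :
    solutionPath (σ.int .a) (σ.int .b) k f (rightBreakpoint σ) (σ.int .b)
      = extDiff x0 (σ.int .b + 1) := by
  have := (green_pos h.a_le_b le_rfl h.a_le_k h.k_le_b).ne'
  rw [h.rightBreakpoint_eq, solutionPath]
  field_simp
  ring

/-- Stopping is correct if no neighbour enters before the budget is met. -/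
theorem wp_stopPivoting (h : LoopInvariant k r x0 t f σ) {ρ : State}
    (hint : ∀ w, w ≠ .inf → w ≠ .left → ρ.int w = σ.int w)
    (hreal : ∀ w, w ≠ .lam → w ≠ .lamA → w ≠ .lamB → w ≠ .T → ρ.real w = σ.real w)
    (harr : ρ.arr = σ.arr)
    (hfin : ∀ lam, onesVec n k ⬝ᵥ x0 - k * lam
      + solutionPath (σ.int .a) (σ.int .b) k f lam k = r →
        NeighboursFeasible x0 (σ.int .a) (σ.int .b)
          (solutionPath (σ.int .a) (σ.int .b) k f lam)) :
    WP stopPivoting ρ fun c σ' => c ≤ 40 ∧ StopState k r x0 f σ σ' := by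
  refine (stopPivoting_spec ρ).mono ?_
  rintro c σ' ⟨hc, hi, hd, ha, hl⟩
  have hpos : 0 < (k : ℝ) - green (σ.int .a) (σ.int .b) k k := by
    have := green_self_lt h.one_le_a h.a_le_k h.k_le_b
    push_cast at this
    linarith
  have hl' : σ'.real .lbar = (onesVec n k ⬝ᵥ x0 - r + f k)
      / ((k : ℝ) - green (σ.int .a) (σ.int .b) k k) := by
    rw [hl, hreal .s (by simp) (by simp) (by simp) (by simp),
      hreal .r (by simp) (by simp) (by simp) (by simp),
      hreal .zk (by simp) (by simp) (by simp) (by simp), hint .k (by simp) (by simp),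
      hint .a (by simp) (by simp), hint .b (by simp) (by simp), hint .pk (by simp) (by simp),
      h.s_eq, h.r_eq, h.zk_eq, h.k_eq, h.pk_eq, mInvVal_eq_green h.a_le_k h.k_le_b]
    norm_cast
  have hbud : onesVec n k ⬝ᵥ x0 - k * σ'.real .lbar
      + solutionPath (σ.int .a) (σ.int .b) k f (σ'.real .lbar) k = r := by
    rw [eq_div_iff hpos.ne'] at hl'
    rw [solutionPath]
    linarith
  refine ⟨hc, hd, fun w e1 e2 e3 => by rw [hi w e1, hint w e2 e3], by rw [ha, harr, h.x_eq], ?_,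
    hbud, hfin _ hbud⟩
  -- Cleared of its denominator, the bound is the budget still violated at the current breakpoint.
  rw [hl', le_div_iff₀ hpos]
  have := h.budget
  rw [solutionPath] at this
  linarith

end LoopInvariant

/-! ### Preservation of the invariant by a pass. -/

namespace LoopInvariant

variable {n k : ℕ} {r : ℝ} {x0 : Fin n → ℝ} {t : ℕ} {f : ℤ → ℝ} {σ : State}

/-- The budget is met before the parameter `lam` if it is not exceeded at `lam`. -/
theorem le_of_budget (h : LoopInvariant k r x0 t f σ) {lam mu : ℝ}
    (h1 : onesVec n k ⬝ᵥ x0 - k * lam + solutionPath (σ.int .a) (σ.int .b) k f lam k ≤ r)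
    (h2 : onesVec n k ⬝ᵥ x0 - k * mu + solutionPath (σ.int .a) (σ.int .b) k f mu k = r) :
    mu ≤ lam := by
  have hpos := green_self_lt h.one_le_a h.a_le_k h.k_le_b
  push_cast at hpos
  rw [solutionPath] at h1 h2
  by_contra hlt
  nlinarith

/-- Old and new path coincide at the breakpoint, so the budget, the signs and the right neighbour
row carry over unchanged; only the new left neighbour needs an argument. -/
theorem wp_updateBasis_left (h : LoopInvariant k r x0 t f σ) (hx : Antitone x0) {ρ : State}
    (ha : 2 ≤ σ.int .a)
    (hleft : ρ.int .left = 1)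
    (hint : ∀ w, w ≠ .inf → w ≠ .left → ρ.int w = σ.int w)
    (hreal : ∀ w, w ≠ .lam → w ≠ .lamA → w ≠ .lamB → w ≠ .T → ρ.real w = σ.real w)
    (harr : ρ.arr = σ.arr) (hlam : ρ.real .lam = leftBreakpoint σ)
    (hright : σ.int .b + 2 ≤ n → leftBreakpoint σ ≤ rightBreakpoint σ)
    (hbud : r < onesVec n k ⬝ᵥ x0 - k * ρ.real .lam
      + solutionPath (σ.int .a) (σ.int .b) k f (ρ.real .lam) k) :
    WP updateBasis ρ fun c σ' => c ≤ 150 ∧ PivotStep k x0 f σ σ' ∧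
      ∃ f', LoopInvariant k r x0 (t + 1) f' σ' := by
  obtain ⟨z, hz⟩ : ∃ z, z = (ρ.real .za - (ρ.arr .x (ρ.int .a - 1) - ρ.arr .x (ρ.int .a)))
    / ρ.real .sig := ⟨_, rfl⟩
  refine (updateBasis_spec_left hleft hz).mono ?_
  rintro c σ' ⟨hc, hx', hi', ha', hpk', hpb', ht', hr', hza', hzk', hzb', hsig'⟩
  have ea : ρ.int .a = σ.int .a := hint _ (by simp) (by simp)
  have eb : ρ.int .b = σ.int .b := hint _ (by simp) (by simp)
  have ez : ρ.real .za = σ.real .za := hreal _ (by simp) (by simp) (by simp) (by simp)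
  have esig : ρ.real .sig = σ.real .sig := hreal _ (by simp) (by simp) (by simp) (by simp)
  have hb' : σ'.int .b = σ.int .b := by
    rw [hi' _ (by simp) (by simp) (by simp) (by simp), eb]
  have hlam' : σ'.real .lam = leftBreakpoint σ := by
    rw [hr' _ (by simp) (by simp) (by simp) (by simp), hlam]
  have hsigpos : σ.real .sig ≠ 0 := by
    rw [h.sig_eq]
    positivity
  have hzeq : z * (2 - green (σ.int .a) (σ.int .b) (σ.int .a) (σ.int .a))
      = f (σ.int .a) + paramRhs k x0 0 (σ.int .a - 1) := by
    rw [green_left h.a_le_b, ← h.sig_eq_schur, hz, esig, div_mul_cancel₀ _ hsigpos, ez, h.za_eq,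
      harr, ea, h.x_eq, paramRhs, extDiff, sub_add_cancel]
    ring
  have hsol := h.solves.schur_left h.a_le_b hzeq
  have hlam0 := h.lam_nonneg
  have hge : σ.real .lam ≤ leftBreakpoint σ :=
    (h.solutionPath_a_le_iff _).mp (h.neighbours.1 ha)
  have hnb : NeighboursFeasible x0 (σ.int .a) (σ.int .b)
      (solutionPath (σ.int .a) (σ.int .b) k f (leftBreakpoint σ)) :=
    ⟨fun _ => (h.solutionPath_a_le_iff _).mpr le_rfl,
      fun hb => (h.solutionPath_b_le_iff _).mpr (hright hb)⟩
  -- Both sides solve the enlarged problem: the old path is zero at `a - 1`, and the equation there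
  -- says exactly that the entering row vanishes.
  have hpath : solutionPath (σ.int .a - 1) (σ.int .b) k
      (fun i => f i + z * (green (σ.int .a) (σ.int .b) (σ.int .a) i
        + if i = σ.int .a - 1 then 1 else 0)) (leftBreakpoint σ)
      = solutionPath (σ.int .a) (σ.int .b) k f (leftBreakpoint σ) := by
    have h1 := h.a_le_k
    refine (solvesPoisson_solutionPath (by omega) h.k_le_b hsol _).unique
      (by have := h.a_le_b; omega)
      ((solvesPoisson_solutionPath h.a_le_k h.k_le_b h.solves (leftBreakpoint σ)).extend_left ?_)
    rw [h.solutionPath_leftBreakpoint, paramRhs, if_neg (by omega)]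
    ring
  have hg1 := (solvesPoisson_green le_rfl h.a_le_b).1 (σ.int .a - 1) (by omega)
  refine ⟨hc, ⟨by rw [hlam']; exact hge, by rw [hlam']; exact hnb,
    .inl ⟨by rw [ha', ea], hb'⟩⟩, (fun i => f i + z * (green (σ.int .a) (σ.int .b) (σ.int .a) i
        + if i = σ.int .a - 1 then 1 else 0)), ?_⟩
  have h1 := h.a_le_k
  have h2 := h.k_le_b
  have h3 := h.b_le
  have h4 := h.size_eq
  have e5 := h.a_le_b
  rw [ea] at ha'
  exact
    { n_eq := by rw [hi' _ (by simp) (by simp) (by simp) (by simp), hint _ (by simp) (by simp),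
        h.n_eq]
      k_eq := by rw [hi' _ (by simp) (by simp) (by simp) (by simp), hint _ (by simp) (by simp),
        h.k_eq]
      done_eq := by rw [hi' _ (by simp) (by simp) (by simp) (by simp),
        hint _ (by simp) (by simp), h.done_eq]
      ret_eq := by rw [hi' _ (by simp) (by simp) (by simp) (by simp),
        hint _ (by simp) (by simp), h.ret_eq]
      t_eq := by rw [ht', hint _ (by simp) (by simp), h.t_eq]; push_cast; ring
      one_le_a := by omega
      a_le_k := by omega
      k_le_b := by omega
      b_le := by omega
      size_eq := by push_cast; omega
      pk_eq := by rw [hpk', hint _ (by simp) (by simp), h.pk_eq, ha']; ring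
      pb_eq := by rw [hpb', hint _ (by simp) (by simp), h.pb_eq, ha', hb']; ring
      x_eq := by rw [hx', harr, h.x_eq]
      r_eq := by rw [hr' _ (by simp) (by simp) (by simp) (by simp),
        hreal _ (by simp) (by simp) (by simp) (by simp), h.r_eq]
      s_eq := by rw [hr' _ (by simp) (by simp) (by simp) (by simp),
        hreal _ (by simp) (by simp) (by simp) (by simp), h.s_eq]
      solves := by rw [ha', hb']; exact hsol
      za_eq := by rw [hza', ha', h.solves.1 _ (by omega), hg1, if_pos rfl]; ring
      zk_eq := by
        rw [hzk', hreal _ (by simp) (by simp) (by simp) (by simp), h.zk_eq, ea, eb,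
          hint _ (by simp) (by simp), h.pk_eq, mInvVal_one_right h1 h2, if_neg (by omega),
          add_zero]
      zb_eq := by
        rw [hzb', hreal _ (by simp) (by simp) (by simp) (by simp), h.zb_eq, ea, eb,
          hint _ (by simp) (by simp), h.pb_eq, mInvVal_one_right e5 le_rfl, hb',
          if_neg (by omega), add_zero]
      sig_eq := by
        rw [hsig', hint _ (by simp) (by simp), h.t_eq]
        push_cast
        ring
      lam_nonneg := by rw [hlam']; linarith
      budget := by rw [ha', hb', hlam', hpath]; rwa [hlam] at hbud
      path_nonneg := fun i => by
        rw [ha', hb', hlam', hpath]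
        exact (h.path_nonneg i).trans (solutionPath_mono h1 h2 f hge i)
      neighbours := by
        rw [ha', hb', hlam', hpath]
        -- The entering component is zero at the breakpoint, so the row of the new left neighbour is
        -- an entry of `q`.
        refine ⟨fun hh => ?_, hnb.2⟩
        rw [(solvesPoisson_solutionPath h1 h2 h.solves _).1 _ (by omega)]
        exact extDiff_nonneg hx (by omega) (by omega) }

/-- Mirror image of `wp_updateBasis_left`; the position of `k` does not move when the basis grows to
the right. -/
theorem wp_updateBasis_right (h : LoopInvariant k r x0 t f σ) (hx : Antitone x0) {ρ : State}
    (hb : σ.int .b + 2 ≤ n) (hleft : ρ.int .left = 0)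
    (hint : ∀ w, w ≠ .inf → w ≠ .left → ρ.int w = σ.int w)
    (hreal : ∀ w, w ≠ .lam → w ≠ .lamA → w ≠ .lamB → w ≠ .T → ρ.real w = σ.real w)
    (harr : ρ.arr = σ.arr) (hlam : ρ.real .lam = rightBreakpoint σ)
    (hright : 2 ≤ σ.int .a → rightBreakpoint σ ≤ leftBreakpoint σ)
    (hbud : r < onesVec n k ⬝ᵥ x0 - k * ρ.real .lam
      + solutionPath (σ.int .a) (σ.int .b) k f (ρ.real .lam) k) :
    WP updateBasis ρ fun c σ' => c ≤ 150 ∧ PivotStep k x0 f σ σ' ∧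
      ∃ f', LoopInvariant k r x0 (t + 1) f' σ' := by
  obtain ⟨z, hz⟩ : ∃ z, z = (ρ.real .zb
    - (ρ.arr .x (ρ.int .b + 1) - ρ.arr .x (ρ.int .b + 1 + 1))) / ρ.real .sig := ⟨_, rfl⟩
  refine (updateBasis_spec_right hleft hz).mono ?_
  rintro c σ' ⟨hc, hx', hi', hb', hpb', ht', hr', hzb', hza', hzk', hsig'⟩
  have ea : ρ.int .a = σ.int .a := hint _ (by simp) (by simp)
  have eb : ρ.int .b = σ.int .b := hint _ (by simp) (by simp)
  have ez : ρ.real .zb = σ.real .zb := hreal _ (by simp) (by simp) (by simp) (by simp)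
  have esig : ρ.real .sig = σ.real .sig := hreal _ (by simp) (by simp) (by simp) (by simp)
  have ha' : σ'.int .a = σ.int .a := by
    rw [hi' _ (by simp) (by simp) (by simp), ea]
  have hlam' : σ'.real .lam = rightBreakpoint σ := by
    rw [hr' _ (by simp) (by simp) (by simp) (by simp), hlam]
  have hsigpos : σ.real .sig ≠ 0 := by
    rw [h.sig_eq]
    positivity
  have hzeq : z * (2 - green (σ.int .a) (σ.int .b) (σ.int .b) (σ.int .b))
      = f (σ.int .b) + paramRhs k x0 0 (σ.int .b + 1) := by
    rw [green_right h.a_le_b, ← h.sig_eq_schur, hz, esig, div_mul_cancel₀ _ hsigpos, ez, h.zb_eq,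
      harr, eb, h.x_eq, paramRhs, extDiff]
    ring
  have hsol := h.solves.schur_right h.a_le_b hzeq
  have hlam0 := h.lam_nonneg
  have hge : σ.real .lam ≤ rightBreakpoint σ :=
    (h.solutionPath_b_le_iff _).mp (h.neighbours.2 hb)
  have hnb : NeighboursFeasible x0 (σ.int .a) (σ.int .b)
      (solutionPath (σ.int .a) (σ.int .b) k f (rightBreakpoint σ)) :=
    ⟨fun ha => (h.solutionPath_a_le_iff _).mpr (hright ha),
      fun _ => (h.solutionPath_b_le_iff _).mpr le_rfl⟩
  have hpath : solutionPath (σ.int .a) (σ.int .b + 1) k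
      (fun i => f i + z * (green (σ.int .a) (σ.int .b) (σ.int .b) i
        + if i = σ.int .b + 1 then 1 else 0)) (rightBreakpoint σ)
      = solutionPath (σ.int .a) (σ.int .b) k f (rightBreakpoint σ) := by
    have h1 := h.k_le_b
    refine (solvesPoisson_solutionPath h.a_le_k (by omega) hsol _).unique
      (by have := h.a_le_b; omega)
      ((solvesPoisson_solutionPath h.a_le_k h.k_le_b h.solves
        (rightBreakpoint σ)).extend_right ?_)
    rw [h.solutionPath_rightBreakpoint, paramRhs, if_neg (by omega)]
    ring
  have hg1 := (solvesPoisson_green h.a_le_b le_rfl).1 (σ.int .b + 1) (by omega)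
  refine ⟨hc, ⟨by rw [hlam']; exact hge, by rw [hlam']; exact hnb,
    .inr ⟨ha', by rw [hb', eb]⟩⟩, (fun i => f i + z * (green (σ.int .a) (σ.int .b) (σ.int .b) i
        + if i = σ.int .b + 1 then 1 else 0)), ?_⟩
  have h1 := h.a_le_k
  have h2 := h.k_le_b
  have h3 := h.one_le_a
  have h4 := h.size_eq
  have e5 := h.a_le_b
  rw [eb] at hb'
  exact
    { n_eq := by rw [hi' _ (by simp) (by simp) (by simp), hint _ (by simp) (by simp), h.n_eq]
      k_eq := by rw [hi' _ (by simp) (by simp) (by simp), hint _ (by simp) (by simp), h.k_eq]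
      done_eq := by rw [hi' _ (by simp) (by simp) (by simp), hint _ (by simp) (by simp),
        h.done_eq]
      ret_eq := by rw [hi' _ (by simp) (by simp) (by simp), hint _ (by simp) (by simp), h.ret_eq]
      t_eq := by rw [ht', hint _ (by simp) (by simp), h.t_eq]; push_cast; ring
      one_le_a := by omega
      a_le_k := by omega
      k_le_b := by omega
      b_le := by omega
      size_eq := by push_cast; omega
      pk_eq := by rw [hi' _ (by simp) (by simp) (by simp), hint _ (by simp) (by simp), h.pk_eq,
        ha']
      pb_eq := by rw [hpb', hint _ (by simp) (by simp), h.pb_eq, ha', hb']; ring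
      x_eq := by rw [hx', harr, h.x_eq]
      r_eq := by rw [hr' _ (by simp) (by simp) (by simp) (by simp),
        hreal _ (by simp) (by simp) (by simp) (by simp), h.r_eq]
      s_eq := by rw [hr' _ (by simp) (by simp) (by simp) (by simp),
        hreal _ (by simp) (by simp) (by simp) (by simp), h.s_eq]
      solves := by rw [ha', hb']; exact hsol
      zb_eq := by rw [hzb', hb', h.solves.1 _ (by omega), hg1, if_pos rfl]; ring
      zk_eq := by
        rw [hzk', hreal _ (by simp) (by simp) (by simp) (by simp), h.zk_eq, ea, eb,
          hint _ (by simp) (by simp), h.pk_eq, hint _ (by simp) (by simp), h.pb_eq,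
          mInvVal_eq_green h1 h2, if_neg (by omega), add_zero]
      za_eq := by
        rw [hza', hreal _ (by simp) (by simp) (by simp) (by simp), h.za_eq, ea, eb,
          hint _ (by simp) (by simp), h.pb_eq, mInvVal_one_left e5, ha',
          if_neg (by omega), add_zero]
      sig_eq := by
        rw [hsig', hint _ (by simp) (by simp), h.t_eq]
        push_cast
        ring
      lam_nonneg := by rw [hlam']; linarith
      budget := by rw [ha', hb', hlam', hpath]; rwa [hlam] at hbud
      path_nonneg := fun i => by
        rw [ha', hb', hlam', hpath]
        exact (h.path_nonneg i).trans (solutionPath_mono h1 h2 f hge i)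
      neighbours := by
        rw [ha', hb', hlam', hpath]
        refine ⟨hnb.1, fun hh => ?_⟩
        rw [(solvesPoisson_solutionPath h1 h2 h.solves _).1 _ (by omega)]
        exact extDiff_nonneg hx (by omega) (by omega) }

theorem wp_pivot (h : LoopInvariant k r x0 t f σ) (hx : Antitone x0) :
    WP pivot σ fun c σ' => c ≤ 350 ∧ (StopState k r x0 f σ σ' ∨
      PivotStep k x0 f σ σ' ∧ ∃ f', LoopInvariant k r x0 (t + 1) f' σ') := by
  rw [pivot, wp_seq]
  refine (nextBreakpoint_spec σ).mono ?_
  rintro c ρ ⟨hc, hint, hreal, harr, hcases⟩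
  rw [h.n_eq] at hcases
  have e1 : Test.cost (.ieq IVar.inf 1) = 3 := rfl
  have e2 : Test.cost (.rle RVar.T RVar.r) = 3 := rfl
  have e3 : RExpr.cost (RVar.s - .ofInt IVar.k * RVar.lam + RVar.zk
        + mInv IVar.pk IVar.pk * RVar.lam) ≤ 60 := by decide
  simp only [wp_ite, wp_seq, wp_setR, Test.holds, IExpr.eval_var, IExpr.eval_one, e1, e2]
  refine ⟨fun hinf => ?_, fun hinf => ?_⟩
  · obtain ⟨-, h1, h2⟩ | h' | h' := hcases
    · refine (h.wp_stopPivoting hint (fun w w1 w2 w3 _ => hreal w w1 w2 w3) harr fun lam _ =>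
        ⟨fun h' => absurd h' h1, fun h' => absurd h' h2⟩).mono ?_
      rintro c' σ' ⟨hc', hs⟩
      exact ⟨by omega, .inl hs⟩
    · omega
    · omega
  · have hT : ((RVar.s - .ofInt IVar.k * RVar.lam + RVar.zk
        + mInv IVar.pk IVar.pk * RVar.lam : RExpr).eval ρ) = onesVec n k ⬝ᵥ x0 - k * ρ.real .lam
          + solutionPath (σ.int .a) (σ.int .b) k f (ρ.real .lam) k := by
      simp only [RExpr.eval_add, RExpr.eval_sub, RExpr.eval_mul, RExpr.eval_var, RExpr.eval_ofInt,
        IExpr.eval_var, mInv_eval]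
      rw [hreal .s (by simp) (by simp) (by simp), hreal .zk (by simp) (by simp) (by simp),
        hint .k (by simp) (by simp), hint .a (by simp) (by simp), hint .b (by simp) (by simp),
        hint .pk (by simp) (by simp), h.s_eq, h.zk_eq, h.k_eq, h.pk_eq,
        mInvVal_eq_green h.a_le_k h.k_le_b, solutionPath]
      push_cast
      ring
    have hr : ρ.real .r = r := by rw [hreal _ (by simp) (by simp) (by simp), h.r_eq]
    have hreal' : ∀ z : ℝ, ∀ w, w ≠ .lam → w ≠ .lamA → w ≠ .lamB → w ≠ .T →
        (ρ.setR .T z).real w = σ.real w := by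
      intro z w w1 w2 w3 w4
      rw [State.real_setR, if_neg w4, hreal w w1 w2 w3]
    rw [hT]
    simp only [RExpr.eval_var, State.real_setR, if_true, reduceCtorEq, if_false, hr]
    refine ⟨fun hle => ?_, fun hgt => ?_⟩
    -- The budget is met at the next breakpoint, so the root of the budget equation precedes it,
    -- hence precedes the breakpoints of all existing neighbours.
    · refine (h.wp_stopPivoting (ρ := ρ.setR .T _) hint (hreal' _) harr fun lam hlam' => ?_).mono ?_
      · have hmu := h.le_of_budget hle hlam'
        obtain ⟨h', -⟩ | ⟨-, -, ha, hlam, hAB⟩ | ⟨-, -, hb, hlam, hBA⟩ := hcases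
        · exact absurd h' hinf
        · rw [hlam] at hmu
          exact ⟨fun _ => (h.solutionPath_a_le_iff _).mpr hmu,
            fun hb => (h.solutionPath_b_le_iff _).mpr (hmu.trans (hAB hb))⟩
        · rw [hlam] at hmu
          exact ⟨fun ha => (h.solutionPath_a_le_iff _).mpr (hmu.trans (hBA ha)),
            fun _ => (h.solutionPath_b_le_iff _).mpr hmu⟩
      · rintro c' σ' ⟨hc', hs⟩
        exact ⟨by omega, .inl hs⟩
    · rw [not_le] at hgt
      obtain ⟨h', -⟩ | ⟨-, hl, ha, hlam, hAB⟩ | ⟨-, hl, hb, hlam, hBA⟩ := hcases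
      · exact absurd h' hinf
      · refine (h.wp_updateBasis_left (ρ := ρ.setR .T _) hx ha hl hint (hreal' _) harr
          hlam hAB hgt).mono ?_
        rintro c' σ' ⟨hc', hs⟩
        exact ⟨by omega, .inr hs⟩
      · refine (h.wp_updateBasis_right (ρ := ρ.setR .T _) hx hb hl hint (hreal' _) harr
          hlam hBA hgt).mono ?_
        rintro c' σ' ⟨hc', hs⟩
        exact ⟨by omega, .inr hs⟩

end LoopInvariant

/-! ### The initialization -/

theorem sum_zeroExt_eq {n k : ℕ} (hk : k ≤ n) (x0 : Fin n → ℝ) :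
    ∑ j ∈ Finset.range k, zeroExt x0 ((j : ℤ) + 1) = onesVec n k ⬝ᵥ x0 := by
  rw [onesVec_dotProduct]
  symm
  apply Finset.sum_bij (fun i _ => i.val)
  · intro i hi
    rw [Finset.mem_filter] at hi
    rw [Finset.mem_range]
    exact hi.2
  · intro i _ j _ h
    exact Fin.ext h
  · intro j hj
    rw [Finset.mem_range] at hj
    exact ⟨⟨j, by omega⟩, by simp [hj], rfl⟩
  · intro i _
    rw [zeroExt_val_add_one]

/-- The case `z = 0`. It covers both `k = n`, where no row limits the parameter, and a budget met no
later than the first breakpoint `q_k`. -/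
theorem isSortedProjection_shift {n k : ℕ} {r : ℝ} {x0 : Fin n → ℝ} (hx : Antitone x0)
    (hk : k ≤ n) {lam : ℝ} (h0 : 0 ≤ lam) (hl : k < n → lam ≤ extDiff x0 k)
    (hsum : onesVec n k ⬝ᵥ x0 - k * lam = r) :
    IsSortedProjection k r x0 (x0 - lam • onesVec n k) := by
  refine isSortedProjection_of_isLCPSolution h0 (isLCPSolution_zero hx hl) ?_ ?_
  · rw [basicSolution_empty, mulVec_zero, add_zero]
  · rw [dotProduct_sub, dotProduct_smul, onesVec_dotProduct_self hk, ← hsum, smul_eq_mul, mul_comm]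

theorem isSortedProjection_self {n k : ℕ} {r : ℝ} {x0 : Fin n → ℝ} (hx : Antitone x0)
    (hs : onesVec n k ⬝ᵥ x0 ≤ r) : IsSortedProjection k r x0 x0 := by
  refine isSortedProjection_of_kkt (lam := 0) (z := 0) le_rfl (fun _ => le_rfl) (by simp)
    (fun i => ?_) hs (by simp) (by simp)
  rw [isoD_mulVec, sub_nonneg]
  exact hx (by rw [Fin.le_def]; simp)

/-- For `k = 1` every coordinate of a feasible point is at most the first, hence at most `r`.
Projecting onto these coordinatewise bounds keeps the order. -/
theorem isSortedProjection_min {n : ℕ} (hn : 1 ≤ n) {r : ℝ} {x0 : Fin n → ℝ} (hx : Antitone x0) :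
    IsSortedProjection 1 r x0 (fun i => min (x0 i) r) := by
  have hfirst : ∀ x : Fin n → ℝ, ∀ i : Fin n, ∑ j with j.val < 1, x j = x ⟨0, by omega⟩ := by
    intro x i
    rw [Finset.sum_eq_single_of_mem (⟨0, by omega⟩ : Fin n) (by simp)]
    intro j hj hne
    rw [Finset.mem_filter] at hj
    exact absurd (Fin.ext (by simp only; omega)) hne
  apply isSortedProjection_of_variational
  · refine ⟨?_, fun i j hij => ?_⟩
    · rw [hfirst _ ⟨0, hn⟩]
      exact min_le_right _ _
    · exact min_le_min_right r (hx (by rw [Fin.le_def]; omega))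
  · rintro x ⟨h1, h2⟩
    apply Finset.sum_nonneg
    intro i _
    have hle : x i ≤ r := by
      have hall : ∀ m (hm : m < n), x ⟨m, hm⟩ ≤ x ⟨0, by omega⟩ := by
        intro m
        induction m with
        | zero => intro _; exact le_rfl
        | succ m ih => intro hm; exact (h2 ⟨m, by omega⟩ ⟨m + 1, hm⟩ rfl).trans (ih (by omega))
      rw [hfirst x i] at h1
      exact (hall i.val i.isLt).trans h1
    simp only [Pi.sub_apply]
    rcases le_total (x0 i) r with h | h
    · rw [min_eq_left h, sub_self, zero_mul]
    · rw [min_eq_right h]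
      exact mul_nonneg_of_nonpos_of_nonpos (by linarith) (by linarith)

theorem output_eq_shift {n k : ℕ} {x0 : Fin n → ℝ} {lam : ℝ} {σ : State}
    (h : ∀ j : ℤ, 1 ≤ j → j ≤ n →
      σ.arr .y j = zeroExt x0 j - if j ≤ k then lam else 0) :
    σ.output n = x0 - lam • onesVec n k := by
  funext i
  have hi := i.isLt
  rw [State.output, h _ (by omega) (by omega), zeroExt_val_add_one, Pi.sub_apply, Pi.smul_apply,
    onesVec, smul_eq_mul]
  split_ifs <;> first | omega | simp

theorem solvesPoisson_singleton {n k : ℕ} (x0 : Fin n → ℝ) :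
    SolvesPoisson k k (paramRhs k x0 0) (fun i => if i = k then -extDiff x0 k / 2 else 0) := by
  refine ⟨fun i hi => if_neg (by omega), fun i h1 h2 => ?_⟩
  have : i = k := by omega
  subst this
  simp only [if_true]
  rw [if_neg (by omega), if_neg (by omega), paramRhs]
  ring

/-- The state after the initialization. -/
def SetupResult {n : ℕ} (k : ℕ) (r : ℝ) (x0 : Fin n → ℝ) (σ : State) : Prop :=
  (σ.int .done = 1 ∧ σ.int .ret = 1 ∧ IsSortedProjection k r x0 (σ.output n)) ∨
    (σ.int .a = k ∧ σ.int .b = k ∧ σ.real .lam = extDiff x0 k ∧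
      ∃ f, LoopInvariant k r x0 0 f σ)

theorem wp_returnNow {n k : ℕ} {r : ℝ} {x0 : Fin n → ℝ} {σ : State}
    (h : IsSortedProjection k r x0 (σ.output n)) :
    WP returnNow σ fun c σ' => c = 4 ∧ SetupResult k r x0 σ' := by
  simp only [returnNow, wp_seq, wp_setI]
  exact ⟨rfl, .inl ⟨by simp, by simp, h⟩⟩

theorem wp_setup_sum {n k : ℕ} (r : ℝ) (hk : k ≤ n) (x0 : Fin n → ℝ) :
    WP (.setR .s 0 ;; forLoop .i 1 IVar.k (.setR .s (RVar.s + RExpr.get .x IVar.i)))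
      (startState k r x0) fun c σ => c ≤ 13 * k + 8 ∧
        (∀ w, w ≠ .i → σ.int w = (startState k r x0).int w) ∧ σ.arr .x = zeroExt x0 ∧
        σ.real .r = r ∧ σ.real .s = onesVec n k ⬝ᵥ x0 := by
  rw [wp_seq, wp_setR]
  have e2 : IExpr.cost (1 : IExpr) = 1 := rfl
  have e3 : RExpr.cost (0 : RExpr) = 1 := rfl
  refine (wp_forLoop (H := k) (B := 5) (l := 1) (fun i σ => σ.int .i = i ∧
      (∀ w, w ≠ .i → σ.int w = (startState k r x0).int w) ∧ σ.arr .x = zeroExt x0 ∧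
        σ.real .r = r ∧ σ.real .s = ∑ j ∈ Finset.range (i - 1).toNat, zeroExt x0 ((j : ℤ) + 1))
    rfl ?_ ?_ ?_ (by omega)).mono ?_
  · refine ⟨by simp, fun w hw => by simp [hw], rfl, by simp [startState], by simp⟩
  · rintro i σ ⟨h1, h2, -⟩
    exact ⟨h1, by simp [h2, startState]⟩
  · rintro i σ hi1 hi2 ⟨h1, h2, h3, h4, h5⟩
    rw [wp_setR]
    refine ⟨by decide, by simp [h1], by simp, fun w hw => by simp [hw, h2], by simp [h3],
      by simp [h4], ?_⟩
    simp only [State.real_setI, State.real_setR, if_true, RExpr.eval_add, RExpr.eval_var,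
      RExpr.eval_get, IExpr.eval_var, h1, h3, h5]
    rw [show (i + 1 - 1).toNat = (i - 1).toNat + 1 by omega, Finset.sum_range_succ,
      show (((i - 1).toNat : ℕ) : ℤ) + 1 = i by omega]
  · rintro c σ ⟨hc, -, h2, h3, h4, h5⟩
    rw [show ((k : ℤ) + 1 - 1).toNat = k by omega, sum_zeroExt_eq hk] at h5
    refine ⟨?_, h2, h3, h4, h5⟩
    rw [e2] at hc
    rw [e3]
    simp only [IExpr.cost] at hc
    omega

theorem wp_writeShifted_returnNow {n k : ℕ} {r : ℝ} {x0 : Fin n → ℝ} (hx : Antitone x0)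
    (hk : k ≤ n) {σ : State} (hn : σ.int .n = n) (hki : σ.int .k = k)
    (hxi : σ.arr .x = zeroExt x0) (h0 : 0 ≤ σ.real .lbar)
    (hl : k < n → σ.real .lbar ≤ extDiff x0 k)
    (hsum : onesVec n k ⬝ᵥ x0 - k * σ.real .lbar = r) :
    WP (writeShifted ;; returnNow) σ fun c σ' => c ≤ 18 * n + 22 ∧ SetupResult k r x0 σ' := by
  rw [wp_seq]
  refine (writeShifted_spec hk hn hki).mono ?_
  rintro c ρ ⟨hc, -, -, -, hy⟩
  refine (wp_returnNow ?_).mono (fun c' σ' h => ⟨by omega, h.2⟩)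
  rw [hxi] at hy
  rw [output_eq_shift hy]
  exact isSortedProjection_shift hx hk h0 hl hsum

/-- The basis `{k}` and its registers. -/
theorem wp_setup_basis {n k : ℕ} {r : ℝ} {x0 : Fin n → ℝ} (hx : Antitone x0) (hk1 : 1 ≤ k)
    (hkn : k + 1 ≤ n) {σ : State} (hn : σ.int .n = n) (hki : σ.int .k = k)
    (hdone : σ.int .done = 0) (hret : σ.int .ret = 0) (hxi : σ.arr .x = zeroExt x0)
    (hr : σ.real .r = r) (hs : σ.real .s = onesVec n k ⬝ᵥ x0)
    (hlam : σ.real .lam = extDiff x0 k)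
    (hbud : r < onesVec n k ⬝ᵥ x0 - k * extDiff x0 k) :
    WP (.setI .t 1 ;; .setI .a IVar.k ;; .setI .b IVar.k ;; .setI .pk 1 ;; .setI .pb 1 ;;
     .setR .zk (-(qAt IVar.k * mInv IVar.pk IVar.pk)) ;; .setR .za RVar.zk ;; .setR .zb RVar.zk ;;
     .setR .sig (2 - mInv IVar.pk IVar.pk)) σ fun c σ' => c ≤ 120 ∧ SetupResult k r x0 σ' := by
  have hq : 0 ≤ extDiff x0 k := extDiff_nonneg hx (by omega) (by omega)
  have hm : mInvVal 1 1 1 = 1 / 2 := by norm_num [mInvVal]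
  simp only [wp_seq, wp_setI, wp_setR]
  refine ⟨by decide, .inr ⟨by simp [hki], by simp [hki], by simp [hlam],
    fun i => if i = k then -extDiff x0 k / 2 else 0, ?_⟩⟩
  have hgreen : green k k k k = 1 / 2 := by
    rw [green_left le_rfl]
    norm_num
  -- At `lam = q_k` the basic solution for `{k}` is zero, so the invariant at the first breakpoint
  -- reduces to `q ≥ 0` and the failed budget test.
  have hpath0 : solutionPath k k k (fun i => if i = k then -extDiff x0 k / 2 else 0)
      (extDiff x0 k) = 0 := by
    funext i
    by_cases hi : i = k
    · subst hi
      simp only [solutionPath, if_true, hgreen, Pi.zero_apply]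
      ring
    · rw [solutionPath, if_neg hi, (solvesPoisson_green le_rfl le_rfl).1 i (by omega)]
      simp
  exact
    { n_eq := by simp [hn]
      k_eq := by simp [hki]
      done_eq := by simp [hdone]
      ret_eq := by simp [hret]
      t_eq := by simp
      one_le_a := by simp [hki]; omega
      a_le_k := by simp [hki]
      k_le_b := by simp [hki]
      b_le := by simp [hki]; omega
      size_eq := by simp
      pk_eq := by simp [hki]
      pb_eq := by simp [hki]
      x_eq := by simp [hxi]
      r_eq := by simp [hr]
      s_eq := by simp [hs]
      solves := by simpa [hki] using solvesPoisson_singleton x0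
      za_eq := by simp [hki, hm, hxi, extDiff]; ring
      zk_eq := by simp [hki, hm, hxi, extDiff]; ring
      zb_eq := by simp [hki, hm, hxi, extDiff]; ring
      sig_eq := by simp [hm]; norm_num
      lam_nonneg := by simpa [hlam] using hq
      budget := by
        simp only [State.int_setR, State.int_setI, State.real_setR, State.real_setI,
          reduceCtorEq, if_true, if_false, IExpr.eval_var, hki, hlam]
        rw [hpath0]
        simpa using hbud
      path_nonneg := by
        simp only [State.int_setR, State.int_setI, State.real_setR, State.real_setI,
          reduceCtorEq, if_true, if_false, IExpr.eval_var, hki, hlam]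
        rw [hpath0]
        intro i
        exact le_rfl
      neighbours := by
        simp only [State.int_setR, State.int_setI, State.real_setR, State.real_setI,
          reduceCtorEq, if_true, if_false, IExpr.eval_var, hki, hlam]
        rw [hpath0]
        exact ⟨fun h => extDiff_nonneg hx (by omega) (by omega),
          fun h => extDiff_nonneg hx (by omega) (by omega)⟩ }

theorem setup_spec {n k : ℕ} (r : ℝ) {x0 : Fin n → ℝ} (hx : Antitone x0) (hk1 : 1 ≤ k)
    (hk : k ≤ n) :
    WP setup (startState k r x0) fun c σ => c ≤ 300 * n ∧ SetupResult k r x0 σ := by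
  -- Sequencing associates to the right, but the summation phase groups the first two statements.
  have hassoc : ∀ p p' p'' : Stmt, ∀ σ Q, WP ((p ;; p') ;; p'') σ Q → WP (p ;; p' ;; p'') σ Q := by
    intro p p' p'' σ Q h
    simp only [wp_seq, add_assoc] at h ⊢
    exact h
  rw [setup]
  apply hassoc
  rw [wp_seq]
  refine (wp_setup_sum r hk x0).mono ?_
  rintro c σ ⟨hc, hint, hxi, hr, hs⟩
  have hn : σ.int .n = n := hint _ (by simp)
  have hki : σ.int .k = k := hint _ (by simp)
  have e0 : Test.cost (.rle RVar.s RVar.r) = 3 := rfl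
  have e1 : Test.cost (.ieq IVar.k 1) = 3 := rfl
  have e2 : Test.cost (.ieq IVar.k IVar.n) = 3 := rfl
  have e3 : Test.cost (.rle RVar.T RVar.r) = 3 := rfl
  have ci1 : IExpr.cost (1 : IExpr) = 1 := rfl
  have cr2 : RExpr.cost (.get .x IVar.i) = 2 := rfl
  have cr3 : RExpr.cost (.min (.get .x IVar.i) RVar.r) = 4 := rfl
  have cr4 : RExpr.cost ((RVar.s - RVar.r) / .ofInt IVar.n) = 6 := rfl
  have cr5 : RExpr.cost ((RVar.s - RVar.r) / .ofInt IVar.k) = 6 := rfl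
  have cr6 : RExpr.cost (qAt IVar.k) ≤ 10 := by decide
  have cr7 : RExpr.cost (RVar.s - .ofInt IVar.k * RVar.lam) = 6 := rfl
  rw [wp_ite]
  refine ⟨fun hle => ?_, fun hgt => ?_⟩
  · have hle' : onesVec n k ⬝ᵥ x0 ≤ r := by rw [← hs, ← hr]; exact hle
    rw [wp_seq]
    refine (wp_forLoop_put (H := n) (l := 1) (F := zeroExt x0) rfl (by omega)
      (fun σ' h => by simp [h, hn]) (fun σ' h1 h2 => by simp [h2, hxi])).mono ?_
    rintro c' σ' ⟨hc', -, -, -, hy⟩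
    refine (wp_returnNow (n := n) (k := k) (r := r) (x0 := x0) ?_).mono
      (fun c'' σ'' h => ⟨?_, h.2⟩)
    · convert isSortedProjection_self hx hle'
      funext i
      have hi := i.isLt
      rw [State.output, hy, if_pos (by omega), zeroExt_val_add_one]
    · have := h.1
      rw [ci1, cr2] at hc'
      simp only [IExpr.cost] at hc'
      omega
  have hgt' : r < onesVec n k ⬝ᵥ x0 := by
    rw [← hs, ← hr]
    exact lt_of_not_ge hgt
  rw [wp_ite]
  refine ⟨fun hk' => ?_, fun hk' => ?_⟩
  · have hk2 : (k : ℤ) = 1 := by rw [← hki]; exact hk'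
    have hk3 : k = 1 := by omega
    rw [wp_seq]
    refine (wp_forLoop_put (H := n) (l := 1) (F := fun j => min (zeroExt x0 j) r) rfl (by omega)
      (fun σ' h => by simp [h, hn]) (fun σ' h1 h2 => by simp [h1, h2, hxi, hr])).mono ?_
    rintro c' σ' ⟨hc', -, -, -, hy⟩
    refine (wp_returnNow (n := n) (k := k) (r := r) (x0 := x0) ?_).mono
      (fun c'' σ'' h => ⟨?_, h.2⟩)
    · rw [hk3]
      convert isSortedProjection_min (by omega : 1 ≤ n) hx
      rename_i i
      have hi := i.isLt
      rw [State.output, hy, if_pos (by omega), zeroExt_val_add_one]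
    · have := h.1
      rw [ci1, cr3] at hc'
      simp only [IExpr.cost] at hc'
      omega
  have hk2 : 2 ≤ k := by
    have : ¬ (k : ℤ) = 1 := by rw [← hki]; exact hk'
    omega
  have hkpos : (0 : ℝ) < k := by positivity
  rw [wp_ite]
  refine ⟨fun hkn => ?_, fun hkn => ?_⟩
  · have hkn' : (k : ℤ) = n := by rw [← hki, ← hn]; exact hkn
    rw [wp_seq, wp_setR]
    have hlb : ((σ.real .s - σ.real .r) / (σ.int .n : ℝ)) = (onesVec n k ⬝ᵥ x0 - r) / k := by
      rw [hs, hr, hn, ← hkn']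
      norm_cast
    refine (wp_writeShifted_returnNow (n := n) (k := k) (r := r) (x0 := x0) hx hk
      (by simp [hn]) (by simp [hki]) (by simp [hxi]) ?_ ?_ ?_).mono (fun c' σ' h => ⟨?_, h.2⟩)
    · simp [hlb]
      exact div_nonneg (by linarith) hkpos.le
    · omega
    · simp [hlb]
      field_simp
      ring
    · have := h.1
      omega
  have hkn' : k + 1 ≤ n := by
    have : ¬ (k : ℤ) = n := by rw [← hki, ← hn]; exact hkn
    omega
  have hq : 0 ≤ extDiff x0 k := extDiff_nonneg hx (by omega) (by omega)
  have hqeq : (qAt IVar.k).eval σ = extDiff x0 k := by simp [hki, hxi, extDiff]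
  rw [wp_seq, wp_setR, wp_seq, wp_setR, wp_ite]
  have hT : (RVar.s - .ofInt IVar.k * RVar.lam : RExpr).eval
      (σ.setR .lam ((qAt IVar.k).eval σ)) = onesVec n k ⬝ᵥ x0 - k * extDiff x0 k := by
    rw [hqeq]
    simp [hs, hki]
  rw [hqeq] at hT ⊢
  rw [hT]
  refine ⟨fun hle => ?_, fun hgt2 => ?_⟩
  · have hle' : onesVec n k ⬝ᵥ x0 - k * extDiff x0 k ≤ r := by
      simpa [Test.holds, hr] using hle
    rw [wp_seq, wp_setR]
    refine (wp_writeShifted_returnNow (n := n) (k := k) (r := r) (x0 := x0) hx hk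
      (by simp [hn]) (by simp [hki]) (by simp [hxi]) ?_ ?_ ?_).mono (fun c' σ' h => ⟨?_, h.2⟩)
    · simp [hs, hr, hki]
      exact div_nonneg (by linarith) hkpos.le
    · intro _
      simp [hs, hr, hki]
      rw [div_le_iff₀ hkpos]
      linarith
    · simp [hs, hr, hki]
      field_simp
      ring
    · have := h.1
      omega
  · have hgt3 : r < onesVec n k ⬝ᵥ x0 - k * extDiff x0 k := by
      simp [Test.holds, hr] at hgt2
      linarith
    refine (wp_setup_basis (n := n) (k := k) (r := r) (x0 := x0) hx hk1 hkn' ?_ ?_ ?_ ?_ ?_ ?_ ?_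
      ?_ ?_).mono (fun c' σ' h => ⟨by have := h.1; omega, h.2⟩)
    · simp [hn]
    · simp [hki]
    · simp [hint, startState]
    · simp [hint, startState]
    · simp [hxi]
    · simp [hr]
    · simp [hs]
    · simp
    · exact hgt3

/-! ### The whole run -/

/-- Induction on the room left for the basis: in pass `t` it has `t + 1` of the `n - 1` indices, so
the invariant is contradictory once `n ≤ t + 1`. -/
theorem exists_passes {n k : ℕ} {r : ℝ} {x0 : Fin n → ℝ} (hx : Antitone x0) (m : ℕ) :
    ∀ (t : ℕ) (f : ℤ → ℝ) (σ₀ : State), n ≤ t + 1 + m → LoopInvariant k r x0 t f σ₀ →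
      ∃ (N : ℕ) (σ : ℕ → State) (F : ℕ → ℤ → ℝ), σ 0 = σ₀ ∧ 0 < N ∧
        (∀ s < N, LoopInvariant k r x0 (t + s) (F s) (σ s)) ∧
        (∀ s < N, ∃ c ≤ 350, Exec pivot (σ s) c (σ (s + 1))) ∧
        (∀ s, s + 1 < N → PivotStep k x0 (F s) (σ s) (σ (s + 1))) ∧
        (∀ s, s + 1 = N → StopState k r x0 (F s) (σ s) (σ (s + 1))) := by
  induction m with
  | zero =>
    intro t f σ₀ hm h
    have h1 := h.one_le_a
    have h2 := h.b_le
    have h3 := h.size_eq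
    omega
  | succ m ih =>
    intro t f σ₀ hm h
    obtain ⟨c, σ', he, hc, hs | ⟨hs, f', h'⟩⟩ := h.wp_pivot hx
    · refine ⟨1, fun s => if s = 0 then σ₀ else σ', fun _ => f, rfl, one_pos, ?_, ?_, ?_, ?_⟩
      · intro s hs'
        obtain rfl : s = 0 := by omega
        exact h
      · intro s hs'
        obtain rfl : s = 0 := by omega
        exact ⟨c, hc, he⟩
      · intro s hs'
        omega
      · intro s hs'
        obtain rfl : s = 0 := by omega
        exact hs
    · obtain ⟨N, σ, F, h0, hN, h1, h2, h3, h4⟩ := ih (t + 1) f' σ' (by omega) h'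
      refine ⟨N + 1, fun s => s.casesOn σ₀ σ, fun s => s.casesOn f F, rfl, by omega, ?_, ?_, ?_, ?_⟩
      · rintro (_ | s) hs'
        · exact h
        · have := h1 s (by omega)
          rwa [show t + 1 + s = t + (s + 1) by ring] at this
      · rintro (_ | s) hs'
        · refine ⟨c, hc, ?_⟩
          change Exec pivot σ₀ c (σ 0)
          rwa [h0]
        · exact h2 s (by omega)
      · rintro (_ | s) hs'
        · change PivotStep k x0 f σ₀ (σ 0)
          rwa [h0]
        · exact h3 s (by omega)
      · rintro (_ | s) hs'
        · omega
        · exact h4 s (by omega)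

theorem exec_while_of_passes {b : Test} {p : Stmt} {B : ℕ} (N : ℕ) :
    ∀ σ : ℕ → State, (∀ t < N, b.holds (σ t) ∧ ∃ c ≤ B, Exec p (σ t) c (σ (t + 1))) →
      ¬ b.holds (σ N) →
        ∃ c ≤ (b.cost + 1 + B) * N + b.cost + 1, Exec (.while b p) (σ 0) c (σ N) := by
  induction N with
  | zero => exact fun σ _ h => ⟨_, by omega, .whileDone h⟩
  | succ N ih =>
    intro σ h hN
    obtain ⟨hb, c, hc, he⟩ := h 0 (by omega)
    obtain ⟨c', hc', he'⟩ := ih (fun t => σ (t + 1)) (fun t ht => h (t + 1) (by omega)) hN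
    refine ⟨_, ?_, .whileStep hb he he'⟩
    rw [mul_add]
    omega

/-! ### Cardinality, Schur complement and primal point of a basis. -/

namespace LoopInvariant

variable {n k : ℕ} {r : ℝ} {x0 : Fin n → ℝ} {t : ℕ} {f : ℤ → ℝ} {σ : State}

theorem card_basis (h : LoopInvariant k r x0 t f σ) : (σ.basis n).card = t + 1 := by
  have h1 := card_interval (n := n) h.one_le_a (by have := h.a_le_b; omega) h.b_le
  have h2 := h.size_eq
  rw [State.basis]
  omega

theorem basicSolution_zero (h : LoopInvariant k r x0 t f σ) :
    basicSolution k x0 (σ.basis n) 0 = restrictFin (n - 1) f :=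
  basicSolution_interval h.one_le_a h.b_le h.solves

theorem sig_eq_inv (h : LoopInvariant k r x0 t f σ) (i : σ.basis n)
    (hi : (i.1.val : ℤ) + 1 = σ.int .a ∨ (i.1.val : ℤ) + 1 = σ.int .b) :
    σ.real .sig = 2 - (basisM (σ.basis n))⁻¹ i i := by
  rw [h.sig_eq_schur]
  congr 1
  refine Eq.trans ?_ (inv_basisM_apply h.one_le_a h.b_le i i).symm
  rcases hi with hi | hi
  · rw [hi, green_left h.a_le_b]
  · rw [hi, green_right h.a_le_b]

/-- The primal solution computed from the final basis. -/
theorem exists_primal (h : LoopInvariant k r x0 t f σ) (hx : Antitone x0) {σ' : State}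
    (hs : StopState k r x0 f σ σ') :
    ∃ ρ ω : State, (∃ c ≤ 36 * n, Exec writeShifted σ' c ρ) ∧
      (∃ c ≤ 300 * (σ'.basis n).card, Exec addDTz ρ c ω) ∧
      ρ.output n = x0 - σ'.real .lbar • onesVec n k ∧
      ω.output n = x0 - σ'.real .lbar • onesVec n k
        + (isoD n)ᵀ *ᵥ basicSolution k x0 (σ'.basis n) (σ'.real .lbar) ∧
      IsSortedProjection k r x0 (ω.output n) := by
  have h1 := h.one_le_a
  have h2 := h.a_le_k
  have h3 := h.k_le_b
  have h4 := h.b_le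
  have h5 := h.size_eq
  have hcard := h.card_basis
  have ha : σ'.int .a = σ.int .a := hs.int_eq _ (by simp) (by simp) (by simp)
  have hb : σ'.int .b = σ.int .b := hs.int_eq _ (by simp) (by simp) (by simp)
  have hpk : σ'.int .pk = k + 1 - σ.int .a := by
    rw [hs.int_eq _ (by simp) (by simp) (by simp), h.pk_eq]
  have hn : σ'.int .n = n := by rw [hs.int_eq _ (by simp) (by simp) (by simp), h.n_eq]
  have hk : σ'.int .k = k := by rw [hs.int_eq _ (by simp) (by simp) (by simp), h.k_eq]
  have hbasis : σ'.basis n = σ.basis n := by rw [State.basis, State.basis, ha, hb]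
  have hsol := solvesPoisson_solutionPath h2 h3 h.solves (σ'.real .lbar)
  obtain ⟨c, ρ, he, hc, hi, hr, hx', hy⟩ := writeShifted_spec (by omega) hn hk
  rw [hs.x_eq] at hx' hy
  obtain ⟨c', ω, he', hc', hy'⟩ := addDTz_spec (σ := ρ) h2 h3
    (by rw [hi _ (by simp), ha]) (by rw [hi _ (by simp), hb]) (by rw [hi _ (by simp), hpk])
    hx' (by rw [hr]; exact hsol)
  have hρ : ρ.output n = x0 - σ'.real .lbar • onesVec n k := output_eq_shift hy
  have hbs : basicSolution k x0 (σ'.basis n) (σ'.real .lbar)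
      = restrictFin (n - 1) (solutionPath (σ.int .a) (σ.int .b) k f (σ'.real .lbar)) := by
    rw [hbasis]
    exact basicSolution_interval h1 h4 hsol
  have hω : ω.output n = x0 - σ'.real .lbar • onesVec n k
      + (isoD n)ᵀ *ᵥ basicSolution k x0 (σ'.basis n) (σ'.real .lbar) := by
    rw [← hρ, hbs]
    funext i
    rw [Pi.add_apply, isoD_transpose_mulVec (fun i hi => hsol.1 i (by omega)), State.output, hy',
      add_sub_cancel_right]
    rfl
  refine ⟨ρ, ω, ⟨c, by omega, he⟩, ⟨c', ?_, he'⟩, hρ, hω, ?_⟩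
  · rw [hbasis, hcard]
    omega
  · refine isSortedProjection_of_isLCPSolution (h.lam_nonneg.trans hs.lam_le) ?_ hω ?_
    · rw [hbasis]
      exact h.isLCPSolution hx hs.lam_le le_rfl hs.neighbours
    -- The sum of the first `k` coordinates is `s - k lbar + z_k(lbar)`, which is `r` by the choice
    -- of `lbar`.
    · rw [hω, hbs, dotProduct_add, onesVec_dotProduct_isoD_transpose (by omega) (by omega),
        dotProduct_sub, dotProduct_smul, onesVec_dotProduct_self (by omega), smul_eq_mul,
        mul_comm, hs.budget]

end LoopInvariant

/-! ### The complexity theorem. -/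

theorem mainTheorem2 :
    -- the matrix `M = D Dᵀ`
    (∀ n : ℕ, IsTridiagonal (isoM n) ∧ IsZMatrix (isoM n) ∧ (isoM n).PosDef ∧
      ∀ i j : Fin (n - 1), isoM n i j =
        if i = j then 2 else if i.val + 1 = j.val ∨ j.val + 1 = i.val then -1 else 0) ∧
    -- the inverse of a contiguous principal submatrix of `M`
    (∀ (n : ℕ) (a b : ℤ), 1 ≤ a → a ≤ b → b ≤ (n : ℤ) - 1 →
      IsUnit (basisM (interval n a b)).det ∧
      ∀ i j : interval n a b,
        (basisM (interval n a b))⁻¹ i j =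
          (((b - a + 1) + 1 - max ((i.1.val : ℤ) + 2 - a) ((j.1.val : ℤ) + 2 - a) : ℤ) : ℝ)
            * ((min ((i.1.val : ℤ) + 2 - a) ((j.1.val : ℤ) + 2 - a) : ℤ) : ℝ)
            / (((b - a + 1) + 1 : ℤ) : ℝ)) ∧
    -- the constant is independent of all the data
    ∃ C : ℕ, ∀ (n k : ℕ) (r : ℝ) (x0 : Fin n → ℝ), 1 ≤ k → k ≤ n → Antitone x0 →
      -- total cost and correctness
      (∃ (c : ℕ) (ω : State), Exec plcpAlgorithm (startState k r x0) c ω ∧ c ≤ C * n ∧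
        IsSortedProjection k r x0 (ω.output n)) ∧
      -- the passes of the main loop: `σ 0` is the state at its start, `N` the number of passes
      ∃ (N : ℕ) (σ : ℕ → State),
        (∃ c ≤ C * n, Exec setup (startState k r x0) c (σ 0)) ∧
        N ≤ n - 1 ∧
        ¬ running.holds (σ N) ∧
        -- each pass costs `O(1)`
        (∀ t < N, running.holds (σ t) ∧ ∃ c ≤ C, Exec pivot (σ t) c (σ (t + 1))) ∧
        -- bases are contiguous, contain `k`, and grow by one adjacent element per pivot
        (0 < N → (σ 0).int .a = k ∧ (σ 0).int .b = k) ∧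
        (∀ t < N, 1 ≤ (σ t).int .a ∧ (σ t).int .a ≤ k ∧ k ≤ (σ t).int .b ∧
          (σ t).int .b ≤ (n : ℤ) - 1 ∧ ((σ t).basis n).card = t + 1) ∧
        (∀ t, t + 1 < N → (σ t).basis n ⊂ (σ (t + 1)).basis n ∧
          (((σ (t + 1)).int .a = (σ t).int .a - 1 ∧ (σ (t + 1)).int .b = (σ t).int .b) ∨
            ((σ (t + 1)).int .a = (σ t).int .a ∧ (σ (t + 1)).int .b = (σ t).int .b + 1))) ∧
        (∀ t, t + 1 = N → (σ N).int .a = (σ t).int .a ∧ (σ N).int .b = (σ t).int .b) ∧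
        -- the registers hold the three components of `z(0)` and the Schur complement
        (∀ t < N,
          (∀ i : Fin (n - 1), (i.val : ℤ) + 1 = (σ t).int .a →
            (σ t).real .za = basicSolution k x0 ((σ t).basis n) 0 i) ∧
          (∀ i : Fin (n - 1), (i.val : ℤ) + 1 = k →
            (σ t).real .zk = basicSolution k x0 ((σ t).basis n) 0 i) ∧
          (∀ i : Fin (n - 1), (i.val : ℤ) + 1 = (σ t).int .b →
            (σ t).real .zb = basicSolution k x0 ((σ t).basis n) 0 i) ∧
          (∀ i : (σ t).basis n,
            ((i.1.val : ℤ) + 1 = (σ t).int .a ∨ (i.1.val : ℤ) + 1 = (σ t).int .b) →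
            (σ t).real .sig = 2 - (basisM ((σ t).basis n))⁻¹ i i)) ∧
        -- each basis is optimal for the LCP between two consecutive breakpoints, the empty one
        -- up to the first breakpoint and the last one up to the final parameter
        (0 < N → 0 ≤ (σ 0).real .lam ∧
          ∀ lam : ℝ, 0 ≤ lam → lam ≤ (σ 0).real .lam →
            IsLCPSolution (isoM n) (plcpQ x0 + lam • plcpD n k) (basicSolution k x0 ∅ lam)) ∧
        (∀ t, t + 1 < N → (σ t).real .lam ≤ (σ (t + 1)).real .lam ∧
          ∀ lam : ℝ, (σ t).real .lam ≤ lam → lam ≤ (σ (t + 1)).real .lam →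
            IsLCPSolution (isoM n) (plcpQ x0 + lam • plcpD n k)
              (basicSolution k x0 ((σ t).basis n) lam)) ∧
        (∀ t, t + 1 = N → (σ t).real .lam ≤ (σ N).real .lbar ∧
          ∀ lam : ℝ, (σ t).real .lam ≤ lam → lam ≤ (σ N).real .lbar →
            IsLCPSolution (isoM n) (plcpQ x0 + lam • plcpD n k)
              (basicSolution k x0 ((σ t).basis n) lam)) ∧
        -- the primal solution: adding `Dᵀ z` to `x0 - lbar 1_k` costs `O(|ξ|)`
        (0 < N → ∃ ρ ω : State,
          (∃ c ≤ C * n, Exec writeShifted (σ N) c ρ) ∧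
          (∃ c ≤ C * ((σ N).basis n).card, Exec addDTz ρ c ω) ∧
          ρ.output n = x0 - (σ N).real .lbar • onesVec n k ∧
          ω.output n = x0 - (σ N).real .lbar • onesVec n k
            + (isoD n)ᵀ *ᵥ basicSolution k x0 ((σ N).basis n) ((σ N).real .lbar) ∧
          IsSortedProjection k r x0 (ω.output n)) := by
  refine ⟨fun n => ⟨isTridiagonal_isoM n, isZMatrix_isoM n, posDef_isoM n, isoM_apply n⟩, ?_,
    -- A generous choice: setup costs at most `300 n`, a pass with its test at most `354`, writing
    -- the shift `36 n`, and adding `Dᵀ z` at most `300` per basis element.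
    2000, ?_⟩
  · intro n a b ha _ hb
    refine ⟨isUnit_det_basisM ha hb, fun i j => ?_⟩
    have hi := mem_interval.mp i.2
    rw [inv_basisM_apply ha hb, green, if_pos hi,
      show (i.1.val : ℤ) + 1 + 1 - a = i.1.val + 2 - a by ring,
      show (j.1.val : ℤ) + 1 + 1 - a = j.1.val + 2 - a by ring]
  intro n k r x0 hk1 hk hx
  have crun : running.cost = 3 := rfl
  have cret : Test.cost (.ieq IVar.ret 1) = 3 := rfl
  obtain ⟨c₀, σ₀, he₀, hc₀, ⟨hd, hr, hproj⟩ | ⟨ha, hb, hl, f, hinv⟩⟩ := setup_spec r hx hk1 hk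
  · have hnot : ¬ running.holds σ₀ := by simp [running, Test.holds, hd]
    refine ⟨⟨_, σ₀, .seq he₀ (.seq (.whileDone hnot) (.iteTrue hr (.skip _))), ?_, hproj⟩, 0,
      fun _ => σ₀, ⟨c₀, by omega, he₀⟩, by omega, hnot, ?_⟩
    · rw [crun, cret]
      omega
    -- A run that returns during the initialization has no passes, so the remaining claims are
    -- vacuous.
    · refine ⟨?_, ?_, ?_, ?_, ?_, ?_, ?_, ?_, ?_, ?_⟩ <;> intros <;> omega
  · obtain ⟨N, σ, F, h0, hN, h1, h2, h3, h4⟩ := exists_passes hx n 0 f σ₀ (by omega) hinv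
    simp only [zero_add] at h1
    obtain ⟨M, rfl⟩ : ∃ M, N = M + 1 := ⟨N - 1, by omega⟩
    have hrun : ∀ t < M + 1, running.holds (σ t) := fun t ht => (h1 t ht).done_eq
    have hlast := h1 M (by omega)
    have hfin := h4 M rfl
    have hbound : M + 1 ≤ n - 1 := by
      have e1 := hlast.one_le_a
      have e2 := hlast.b_le
      have e3 := hlast.size_eq
      omega
    have hnot : ¬ running.holds (σ (M + 1)) := by simp [running, Test.holds, hfin.done_eq]
    have haN : (σ (M + 1)).int .a = (σ M).int .a := hfin.int_eq _ (by simp) (by simp) (by simp)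
    have hbN : (σ (M + 1)).int .b = (σ M).int .b := hfin.int_eq _ (by simp) (by simp) (by simp)
    obtain ⟨ρ, ω, ⟨c₂, hc₂, he₂⟩, ⟨c₃, hc₃, he₃⟩, hρ, hω, hproj⟩ := hlast.exists_primal hx hfin
    obtain ⟨c₁, hc₁, he₁⟩ := exec_while_of_passes (b := running) (p := pivot) (M + 1) σ
      (fun t ht => ⟨hrun t ht, h2 t ht⟩) hnot
    have hcardN : ((σ (M + 1)).basis n).card = M + 1 := by
      rw [State.basis, haN, hbN]
      exact hlast.card_basis
    refine ⟨⟨_, ω, .seq he₀ (.seq (h0 ▸ he₁) (.iteFalse ?_ (.seq he₂ he₃))), ?_, hproj⟩, M + 1, σ,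
      ⟨c₀, by omega, h0 ▸ he₀⟩, hbound, hnot, ?_, ?_, ?_, ?_, ?_, ?_, ?_, ?_, ?_, ?_⟩
    · have : (σ (M + 1)).int .ret = 0 := by
        rw [hfin.int_eq _ (by simp) (by simp) (by simp), hlast.ret_eq]
      simp [Test.holds, this]
    · rw [hcardN] at hc₃
      rw [crun] at hc₁
      rw [cret]
      omega
    · intro t ht
      obtain ⟨c, hc, he⟩ := h2 t ht
      exact ⟨hrun t ht, c, by omega, he⟩
    · intro _
      rw [h0]
      exact ⟨ha, hb⟩
    · intro t ht
      have h := h1 t ht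
      exact ⟨h.one_le_a, h.a_le_k, h.k_le_b, h.b_le, h.card_basis⟩
    · intro t ht
      have hb' := (h3 t ht).basis
      refine ⟨?_, hb'⟩
      refine Finset.ssubset_iff_subset_ne.mpr ⟨?_, ?_⟩
      · intro i hi
        rw [State.basis, mem_interval] at hi ⊢
        omega
      · intro heq
        have e1 := (h1 t (by omega)).card_basis
        have e2 := (h1 (t + 1) ht).card_basis
        rw [heq] at e1
        omega
    · intro t ht
      obtain rfl : t = M := by omega
      exact ⟨haN, hbN⟩
    · intro t ht
      have h := h1 t ht
      rw [h.basicSolution_zero]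
      refine ⟨fun i hi => ?_, fun i hi => ?_, fun i hi => ?_, h.sig_eq_inv⟩
      · rw [restrictFin, hi, h.za_eq]
      · rw [restrictFin, hi, h.zk_eq]
      · rw [restrictFin, hi, h.zb_eq]
    · intro _
      rw [h0]
      refine ⟨hinv.lam_nonneg, fun lam _ hle => isLCPSolution_zero hx fun _ => ?_⟩
      -- The breakpoint register starts at `q_k`, the largest parameter for which the empty basis is
      -- optimal.
      rwa [hl] at hle
    · intro t ht
      have hs := h3 t ht
      exact ⟨hs.lam_le, fun lam e1 e2 =>
        (h1 t (by omega)).isLCPSolution hx e1 e2 hs.neighbours⟩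
    · intro t ht
      obtain rfl : t = M := by omega
      exact ⟨hfin.lam_le, fun lam e1 e2 => hlast.isLCPSolution hx e1 e2 hfin.neighbours⟩
    · intro _
      exact ⟨ρ, ω, ⟨c₂, by omega, he₂⟩, ⟨c₃, by omega, he₃⟩, hρ, hω, hproj⟩
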